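/- Let $(P,\omega)$ be a symplectic manifold of dimension $2m$. Write $\flat(X)=i(X)\omega=\omega(X,\cdot)$, let $\sharp=\flat^{-1}\colon T^*P\to TP$, and let $\Pi$ be the associated Poisson bivector field, normalized by $\beta(\sharp\alpha)=\langle\beta\wedge\alpha,\Pi\rangle$ for $1$-forms $\alpha,\beta$; here and below $\langle\cdot,\cdot\rangle$ is the pairing with $\langle\alpha_1\wedge\cdots\wedge\alpha_k,X_1\wedge\cdots\wedge X_k\rangle=\det(\alpha_i(X_j))$. Let $[\alpha,\beta]_\Pi=\mathcal L_{\sharp\alpha}\beta-\mathcal L_{\sharp\beta}\alpha+d\langle\alpha\wedge\beta,\Pi\rangle$. Put $\mathfrak X^k(P)=\Gamma^\infty(\wedge^kTP)$. A contravariant derivative is an $\mathbb R$-bilinear map $D\colon\Omega^1(P)\times\Omega^1(P)\to\Omega^1(P)$, $(\eta,\alpha)\mapsto D_\eta\alpha$, with $D_{f\eta}\alpha=fD_\eta\alpha$ and $D_\eta(f\alpha)=fD_\eta\alpha+((\sharp\eta)f)\,\alpha$ for $f\in C^\infty(P)$; being local, it also applies to $1$-forms defined on open sets. It extends to $A\in\mathfrak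 X^k(P)$ by $$\langle\alpha_1\wedge\cdots\wedge\alpha_k,D_\eta A\rangle=(\sharp\eta)\langle\alpha_1\wedge\cdots\wedge\alpha_k,A\rangle-\sum_{i=1}^k\langle\alpha_1\wedge\cdots\wedge D_\eta\alpha_i\wedge\cdots\wedge\alpha_k,A\rangle .$$ $D$ is a Poisson connection if $D\Pi=0$, i.e. $(\sharp\alpha)\langle\beta\wedge\gamma,\Pi\rangle=\langle D_\alpha\beta\wedge\gamma,\Pi\rangle+\langle\beta\wedge D_\alpha\gamma,\Pi\rangle$, and it is torsion-free if $D_\alpha\beta-D_\beta\alpha=[\alpha,\beta]_\Pi$ for all $1$-forms $\alpha,\beta,\gamma$. Let $\mu=\frac1{m!}\omega^{m}$ be the Liouville volume form. For $1\le k\le 2m$ the $k$-th curl operator is $\mathfrak C^k_\mu=\mu^\sharp\circ d\circ\mu^\flat\colon\mathfrak X^k(P)\to\mathfrak X^{k-1}(P)$, where $\mu^\flat(A)=i(A)\mu$, $\langle i(A)\mu,B\rangle=\langle\mu,A\wedge B\rangle$, and $\mu^\sharp$ is the inverse of the isomorphism $\mu^\flat$. For a $1$-form $\alpha$ and $A\in\mathfrak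 X^k$ let $i(\alpha)A\in\mathfrak X^{k-1}$ be defined by $\langle\tau,i(\alpha)A\rangle=\langle\tau\wedge\alpha,A\rangle$. Suppose that $D$ is a torsion-free Poisson connection on $(P,\omega)$, and let $(W;x_1,\dots,x_m,y_1,\dots,y_m)$ be Darboux coordinates, i.e. a smooth chart with $\omega|_W=\sum_{i=1}^m dx_i\wedge dy_i$. Then for every $1\le k\le 2m$ and every smooth $k$-vector field $A$ on $W$, $$\mathfrak C^k_\mu A=\sum_{i=1}^m\bigl(i(dx_i)\,D_{dy_i}A-i(dy_i)\,D_{dx_i}A\bigr)\qquad\text{on }W.$$ -/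

import Mathlib

open scoped Manifold ContDiff Topology
open Bundle

noncomputable section

namespace PoissonCurl

/-! ### Linear algebra in a single tangent space -/

section LinearAlgebra

variable {V : Type*} [AddCommGroup V] [Module ℝ V]

/-- The wedge product of alternating forms (sum over shuffles, so that
`(a ∧ b)(u, v) = a u * b v - a v * b u` for covectors `a`, `b`). -/
def wedge {k l : ℕ} (a : V [⋀^Fin k]→ₗ[ℝ] ℝ) (b : V [⋀^Fin l]→ₗ[ℝ] ℝ) :
    V [⋀^Fin (k + l)]→ₗ[ℝ] ℝ :=
  ((LinearMap.mul' ℝ ℝ).compAlternatingMap (a.domCoprod b)).domDomCongr finSumFinEquiv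

/-- The `j`-fold wedge power of a two-form. -/
def wedgePow (σ : V [⋀^Fin 2]→ₗ[ℝ] ℝ) : (j : ℕ) → V [⋀^Fin (2 * j)]→ₗ[ℝ] ℝ
  | 0 => AlternatingMap.constOfIsEmpty ℝ V (Fin 0) (1 : ℝ)
  | j + 1 => wedge (wedgePow σ j) σ

/-- The pairing `⟨α₁ ∧ ⋯ ∧ αₖ, A⟩` of covectors with a `k`-vector, normalized by
`⟨α₁ ∧ ⋯ ∧ αₖ, X₁ ∧ ⋯ ∧ Xₖ⟩ = det (αᵢ Xⱼ)`. -/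
def pairing {k : ℕ} (α : Fin k → Module.Dual ℝ V) (A : ⋀[ℝ]^k V) : ℝ :=
  exteriorPower.pairingDual ℝ V k (exteriorPower.ιMulti ℝ k α) A

theorem contractRight_mem (α : Module.Dual ℝ V) (k : ℕ) :
    ∀ A ∈ ⋀[ℝ]^(k + 1) V,
      CliffordAlgebra.contractRight (Q := (0 : QuadraticForm ℝ V)) A α ∈ ⋀[ℝ]^k V := by
  induction k with
  | zero =>
    intro A hA
    replace hA : A ∈ LinearMap.range (ExteriorAlgebra.ι ℝ : V →ₗ[ℝ] _) ^ (0 + 1) := hA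
    change _ ∈ LinearMap.range (ExteriorAlgebra.ι ℝ : V →ₗ[ℝ] _) ^ 0
    rw [zero_add, pow_one] at hA
    obtain ⟨v, rfl⟩ := hA
    rw [show ExteriorAlgebra.ι ℝ v = CliffordAlgebra.ι (0 : QuadraticForm ℝ V) v from rfl,
      CliffordAlgebra.contractRight_ι, pow_zero]
    exact Submodule.mem_one.mpr ⟨_, rfl⟩
  | succ k ih =>
    intro A hA
    replace hA : A ∈ LinearMap.range (ExteriorAlgebra.ι ℝ : V →ₗ[ℝ] _) ^ (k + 1 + 1) := hA
    change _ ∈ LinearMap.range (ExteriorAlgebra.ι ℝ : V →ₗ[ℝ] _) ^ (k + 1)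
    rw [pow_succ] at hA
    induction hA using Submodule.mul_induction_on' with
    | mem_mul_mem a ha b hb =>
      obtain ⟨v, rfl⟩ := hb
      rw [show ExteriorAlgebra.ι ℝ v = CliffordAlgebra.ι (0 : QuadraticForm ℝ V) v from rfl,
        CliffordAlgebra.contractRight_mul_ι]
      refine Submodule.sub_mem _ (Submodule.smul_mem _ _ ha) ?_
      rw [pow_succ]
      exact Submodule.mul_mem_mul (ih a ha) ⟨v, rfl⟩
    | add x _ y _ hx hy =>
      rw [map_add, LinearMap.add_apply]
      exact Submodule.add_mem _ hx hy

/-- The interior product `i(α)A` of a multivector by a covector: contraction in the last slot,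
`⟨τ, i(α)A⟩ = ⟨τ ∧ α, A⟩`. -/
def contractCovector {k : ℕ} (α : Module.Dual ℝ V) (A : ⋀[ℝ]^(k + 1) V) : ⋀[ℝ]^k V :=
  ⟨CliffordAlgebra.contractRight (Q := (0 : QuadraticForm ℝ V)) A.1 α,
    contractRight_mem α k A.1 A.2⟩

/-- The interior product `i(A)η` of an `N`-form by an `a`-vector, as a `b`-form, `a + b = N`:
`(i(A)η)(v₁, …, v_b) = ⟨η, A ∧ v₁ ∧ ⋯ ∧ v_b⟩`. -/
def interiorProduct {N a b : ℕ} (η : V [⋀^Fin N]→ₗ[ℝ] ℝ) (A : ⋀[ℝ]^a V) : V [⋀^Fin b]→ₗ[ℝ] ℝ :=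
  ((ExteriorAlgebra.liftAlternating (R := ℝ) (Pi.single N η)).comp
    (LinearMap.mulLeft ℝ (A : ExteriorAlgebra ℝ V))).compAlternatingMap
      (ExteriorAlgebra.ιMulti ℝ b)

/-- The inverse of `A ↦ i(A)η` from `a`-vectors to `b`-forms, `η` a volume element of degree
`a + b`. -/
def interiorProductInv {N a b : ℕ} (η : V [⋀^Fin N]→ₗ[ℝ] ℝ) : V [⋀^Fin b]→ₗ[ℝ] ℝ → ⋀[ℝ]^a V :=
  Function.invFun fun A : ⋀[ℝ]^a V => (interiorProduct η A : V [⋀^Fin b]→ₗ[ℝ] ℝ)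

end LinearAlgebra

/-! ### Tensor fields on a manifold without boundary, modelled on `E` -/

variable {E : Type*} [NormedAddCommGroup E] [NormedSpace ℝ E] [FiniteDimensional ℝ E]

/-- On a finite dimensional space every alternating form is continuous. -/
theorem continuous_alternating {k : ℕ} (f : E [⋀^Fin k]→ₗ[ℝ] ℝ) : Continuous f := by
  classical
  let b := Module.finBasis ℝ E
  have h : (f : (Fin k → E) → ℝ) = fun v => ∑ r : Fin k → Fin (Module.finrank ℝ E),
      (∏ i, b.repr (v i) (r i)) * f (fun i => b (r i)) := by
    funext v
    conv_lhs => rw [show v = fun i => ∑ j, b.repr (v i) j • b j from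
      funext fun i => (b.sum_repr (v i)).symm]
    rw [← AlternatingMap.coe_multilinearMap, MultilinearMap.map_sum]
    refine Finset.sum_congr rfl fun r _ => ?_
    rw [MultilinearMap.map_smul_univ, smul_eq_mul]
  rw [h]
  refine continuous_finsetSum _ fun r _ => Continuous.mul ?_ continuous_const
  refine continuous_finsetProd _ fun i _ => ?_
  exact (LinearMap.continuous_of_finiteDimensional (b.coord (r i))).comp (continuous_apply i)

/-- An alternating form on a finite dimensional space, as a continuous alternating form. -/
def toContinuousForm {k : ℕ} (f : E [⋀^Fin k]→ₗ[ℝ] ℝ) : E [⋀^Fin k]→L[ℝ] ℝ :=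
  { f with cont := continuous_alternating f }

variable {P : Type*} [TopologicalSpace P] [ChartedSpace E P]

instance (p : P) : FiniteDimensional ℝ (TangentSpace 𝓘(ℝ, E) p) :=
  inferInstanceAs (FiniteDimensional ℝ E)

instance (p : P) : T2Space (TangentSpace 𝓘(ℝ, E) p) :=
  inferInstanceAs (T2Space E)

variable (E P) in
/-- Vector fields. -/
abbrev VectorField := (p : P) → TangentSpace 𝓘(ℝ, E) p

variable (E P) in
/-- One-forms, as sections of the cotangent bundle. -/
abbrev OneForm := (p : P) → (TangentSpace 𝓘(ℝ, E) p →L[ℝ] ℝ)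

variable (E P) in
/-- Differential `k`-forms. -/
abbrev Form (k : ℕ) := (p : P) → (TangentSpace 𝓘(ℝ, E) p) [⋀^Fin k]→ₗ[ℝ] ℝ

variable (E P) in
/-- `k`-vector fields, as sections of `⋀ᵏ TP`. -/
abbrev MultivectorField (k : ℕ) := (p : P) → ⋀[ℝ]^k (TangentSpace 𝓘(ℝ, E) p)

/-- A real function is smooth at `p`. -/
def SmoothFunAt (f : P → ℝ) (p : P) : Prop :=
  ContMDiffAt 𝓘(ℝ, E) 𝓘(ℝ, ℝ) ∞ f p

/-- The differential of a real function, as a one-form. -/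
def differential (f : P → ℝ) : OneForm E P :=
  fun p => mfderiv 𝓘(ℝ, E) 𝓘(ℝ, ℝ) f p

/-- The pullback of a form under the inverse of a chart `e`. -/
def Form.inChart {k : ℕ} (η : Form E P k) (e : OpenPartialHomeomorph P E) :
    E → E [⋀^Fin k]→L[ℝ] ℝ := fun y =>
  toContinuousForm ((η (e.symm y)).compLinearMap
    (mfderiv 𝓘(ℝ, E) 𝓘(ℝ, E) e.symm y : E →L[ℝ] TangentSpace 𝓘(ℝ, E) (e.symm y)).toLinearMap)

/-- A `k`-form is smooth at `p`: its expression in the preferred chart at `p` is smooth. -/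
def Form.SmoothAt {k : ℕ} (η : Form E P k) (p : P) : Prop :=
  ContDiffAt ℝ ∞ (η.inChart (chartAt E p)) (chartAt E p p)

/-- The exterior derivative, computed in the preferred chart at each point:
`(dη)(p) = φ^* d((φ⁻¹)^* η)`. -/
def Form.d {k : ℕ} (η : Form E P k) : Form E P (k + 1) := fun p =>
  (extDeriv (η.inChart (chartAt E p)) (chartAt E p p)).toAlternatingMap.compLinearMap
    (mfderiv 𝓘(ℝ, E) 𝓘(ℝ, E) (chartAt E p) p : TangentSpace 𝓘(ℝ, E) p →L[ℝ] E).toLinearMap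

/-- A one-form, regarded as a differential form of degree `1`. -/
def OneForm.toForm (α : OneForm E P) : Form E P 1 := fun p =>
  AlternatingMap.ofSubsingleton ℝ (TangentSpace 𝓘(ℝ, E) p) ℝ 0 (α p).toLinearMap

/-- The covector `i(v)η = η(v, ·)` for a two-form `η`. -/
def contractVector {p : P} (η : (TangentSpace 𝓘(ℝ, E) p) [⋀^Fin 2]→ₗ[ℝ] ℝ)
    (v : TangentSpace 𝓘(ℝ, E) p) : TangentSpace 𝓘(ℝ, E) p →L[ℝ] ℝ :=
  LinearMap.toContinuousLinearMap
    ((AlternatingMap.ofSubsingleton ℝ (TangentSpace 𝓘(ℝ, E) p) ℝ (0 : Fin 1)).symm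
      (η.curryLeft v))

/-- The Lie derivative of a one-form along a vector field, `L_X β = d(i_X β) + i_X dβ`. -/
def lieDerivative (X : VectorField E P) (β : OneForm E P) : OneForm E P := fun p =>
  differential (fun q => β q (X q)) p + contractVector (β.toForm.d p) (X p)

/-! ### Symplectic forms and their Poisson structure -/

/-- A symplectic form: a smooth, closed, nondegenerate two-form. -/
structure IsSymplectic (σ : Form E P 2) : Prop where
  smooth : ∀ p, σ.SmoothAt p
  closed : ∀ p, σ.d p = 0
  nondegenerate : ∀ (p : P) (X : TangentSpace 𝓘(ℝ, E) p), (∀ Y, σ p ![X, Y] = 0) → X = 0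

/-- `♭ X = i(X)σ = σ(X, ·)`. -/
def flat (σ : Form E P 2) (p : P) (X : TangentSpace 𝓘(ℝ, E) p) :
    TangentSpace 𝓘(ℝ, E) p →L[ℝ] ℝ :=
  contractVector (σ p) X

/-- `♯`, the inverse of `♭`. -/
def sharp (σ : Form E P 2) (p : P) : (TangentSpace 𝓘(ℝ, E) p →L[ℝ] ℝ) → TangentSpace 𝓘(ℝ, E) p :=
  Function.invFun (flat σ p)

/-- The Poisson tensor of `σ` on one-forms: `⟨β ∧ α, Π⟩ = β(♯α)`. -/
def poisson (σ : Form E P 2) (β α : OneForm E P) : P → ℝ :=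
  fun p => β p (sharp σ p (α p))

/-- The bracket `[α, β]_Π = L_{♯α} β - L_{♯β} α + d⟨α ∧ β, Π⟩` of one-forms. -/
def oneFormBracket (σ : Form E P 2) (α β : OneForm E P) : OneForm E P :=
  lieDerivative (fun p => sharp σ p (α p)) β - lieDerivative (fun p => sharp σ p (β p)) α
    + differential (poisson σ α β)

/-- The Liouville volume form `μ = σᵐ / m!`. -/
def liouville (σ : Form E P 2) (m : ℕ) : Form E P (2 * m) :=
  fun p => ((m.factorial : ℝ)⁻¹) • wedgePow (σ p) m

/-! ### The curl operator -/

/-- The curl operator `C_μ = μ^♯ ∘ d ∘ μ^♭` on multivector fields of degree `k + 1`, with respect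
to a volume form `μ` of degree `N`, where `1 ≤ k + 1 ≤ N`: here `μ^♭ A = i(A)μ` is a form of
degree `N - (k + 1)`, and `μ^♯` is the inverse of `μ^♭`. -/
def curl {N k : ℕ} (μ : Form E P N) (A : MultivectorField E P (k + 1)) : MultivectorField E P k :=
  let μA : Form E P (N - (k + 1)) := fun p => interiorProduct (μ p) (A p)
  fun p => interiorProductInv (μ p) (μA.d p)

/-! ### Contravariant derivatives -/

variable [IsManifold 𝓘(ℝ, E) ∞ P]

/-- A one-form is smooth at `p`, as a section of the cotangent bundle. -/
def OneForm.SmoothAt (α : OneForm E P) (p : P) : Prop :=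
  ContMDiffAt 𝓘(ℝ, E) (𝓘(ℝ, E).prod 𝓘(ℝ, E →L[ℝ] ℝ)) ∞
    (fun q => TotalSpace.mk' (E →L[ℝ] ℝ) (E := fun x : P => TangentSpace 𝓘(ℝ, E) x →L[ℝ] ℝ)
      q (α q)) p

/-- A `k`-vector field is smooth at `p`: its pairings with smooth one-forms are smooth. -/
def MultivectorField.SmoothAt {k : ℕ} (A : MultivectorField E P k) (p : P) : Prop :=
  ∀ α : Fin k → OneForm E P, (∀ i, (α i).SmoothAt p) →
    SmoothFunAt (E := E) (fun q => pairing (fun i => (α i q).toLinearMap) (A q)) p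

/-- A contravariant derivative `D` on `(P, σ)`. The value `D α p : T_p^*P → T_p^*P`, an element of
`T_pP ⊗ T_p^*P`, sends `η` to `(D_η α)(p)`; so `C^∞`-linearity in `η` is built in.
As for Mathlib's covariant derivatives, `D` is applied to arbitrary sections (so that it can be
applied to one-forms that are only given locally), but it is required to satisfy its axioms only at
the points where they are smooth. -/
structure ContravariantDerivative (σ : Form E P 2) where
  toFun : OneForm E P → (p : P) →
    ((TangentSpace 𝓘(ℝ, E) p →L[ℝ] ℝ) →L[ℝ] (TangentSpace 𝓘(ℝ, E) p →L[ℝ] ℝ))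
  smooth : ∀ (α η : OneForm E P) (p : P), α.SmoothAt p → η.SmoothAt p →
    OneForm.SmoothAt (fun q => toFun α q (η q)) p
  add : ∀ (α β : OneForm E P) (p : P), α.SmoothAt p → β.SmoothAt p →
    toFun (α + β) p = toFun α p + toFun β p
  leibniz : ∀ (f : P → ℝ) (α : OneForm E P) (p : P), SmoothFunAt (E := E) f p → α.SmoothAt p →
    ∀ η : TangentSpace 𝓘(ℝ, E) p →L[ℝ] ℝ,
      toFun (fun q => f q • α q) p η
        = f p • toFun α p η + (differential f p (sharp σ p η)) • α p

namespace ContravariantDerivative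

variable {σ : Form E P 2} (D : ContravariantDerivative σ)

/-- The one-form `D_η α`. -/
def onOneForm (η α : OneForm E P) : OneForm E P := fun p => D.toFun α p (η p)

/-- `D` is a Poisson connection, `DΠ = 0`:
`(♯α)⟨β ∧ γ, Π⟩ = ⟨D_α β ∧ γ, Π⟩ + ⟨β ∧ D_α γ, Π⟩`. -/
def IsPoissonConnection : Prop :=
  ∀ (α β γ : OneForm E P) (p : P), α.SmoothAt p → β.SmoothAt p → γ.SmoothAt p →
    differential (poisson σ β γ) p (sharp σ p (α p))
      = poisson σ (D.onOneForm α β) γ p + poisson σ β (D.onOneForm α γ) p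

/-- The torsion `D_α β - D_β α - [α, β]_Π` vanishes. -/
def IsTorsionFree : Prop :=
  ∀ (α β : OneForm E P) (p : P), α.SmoothAt p → β.SmoothAt p →
    (D.onOneForm α β - D.onOneForm β α - oneFormBracket σ α β) p = 0

/-- `B = (D_η A)(p)`, for a `k`-vector field `A`: for all one-forms `α₁, …, αₖ` smooth at `p`,
`⟨α₁ ∧ ⋯ ∧ αₖ, B⟩ = (♯η)⟨α₁ ∧ ⋯ ∧ αₖ, A⟩ - ∑ᵢ ⟨α₁ ∧ ⋯ ∧ D_η αᵢ ∧ ⋯ ∧ αₖ, A⟩` at `p`. -/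
def IsDerivAt {k : ℕ} (η : OneForm E P) (A : MultivectorField E P k) (p : P)
    (B : ⋀[ℝ]^k (TangentSpace 𝓘(ℝ, E) p)) : Prop :=
  ∀ α : Fin k → OneForm E P, (∀ i, (α i).SmoothAt p) →
    pairing (fun i => (α i p).toLinearMap) B
      = differential (E := E) (fun q => pairing (fun i => (α i q).toLinearMap) (A q)) p
          (sharp σ p (η p))
        - ∑ i, pairing (fun j => (Function.update α i (D.onOneForm η (α i)) j p).toLinearMap) (A p)

/-- The `k`-vector field `D_η A`. -/
def onMultivector {k : ℕ} (η : OneForm E P) (A : MultivectorField E P k) :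
    MultivectorField E P k :=
  fun p => Classical.epsilon (D.IsDerivAt η A p)

end ContravariantDerivative

/-! ### Darboux coordinates -/

/-- The `j`-th coordinate function of a chart. -/
def coord {n : ℕ} {P : Type*} [TopologicalSpace P] [ChartedSpace (EuclideanSpace ℝ (Fin n)) P]
    (e : OpenPartialHomeomorph P (EuclideanSpace ℝ (Fin n))) (j : Fin n) : P → ℝ :=
  fun q => e q j

section Darboux

variable {m : ℕ} {P : Type*} [TopologicalSpace P]
  [ChartedSpace (EuclideanSpace ℝ (Fin (2 * m))) P]

/-- The index of `xᵢ` in `(x₁, …, xₘ, y₁, …, yₘ)`. -/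
def xIndex (i : Fin m) : Fin (2 * m) := ⟨i, by omega⟩

/-- The index of `yᵢ` in `(x₁, …, xₘ, y₁, …, yₘ)`. -/
def yIndex (i : Fin m) : Fin (2 * m) := ⟨m + i, by omega⟩

/-- The coordinate one-form `dxᵢ` of a chart `(x₁, …, xₘ, y₁, …, yₘ)`. -/
def dx (e : OpenPartialHomeomorph P (EuclideanSpace ℝ (Fin (2 * m)))) (i : Fin m) :
    OneForm (EuclideanSpace ℝ (Fin (2 * m))) P :=
  differential (coord e (xIndex i))

/-- The coordinate one-form `dyᵢ` of a chart `(x₁, …, xₘ, y₁, …, yₘ)`. -/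
def dy (e : OpenPartialHomeomorph P (EuclideanSpace ℝ (Fin (2 * m)))) (i : Fin m) :
    OneForm (EuclideanSpace ℝ (Fin (2 * m))) P :=
  differential (coord e (yIndex i))

/-- The chart `e = (x₁, …, xₘ, y₁, …, yₘ)` of the smooth structure is a Darboux chart:
`σ = ∑ᵢ dxᵢ ∧ dyᵢ` on its domain. -/
def IsDarboux (σ : Form (EuclideanSpace ℝ (Fin (2 * m))) P 2)
    (e : OpenPartialHomeomorph P (EuclideanSpace ℝ (Fin (2 * m)))) : Prop :=
  e ∈ IsManifold.maximalAtlas (𝓡 (2 * m)) ∞ P ∧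
    ∀ p ∈ e.source, σ p = ∑ i, wedge ((dx e i).toForm p) ((dy e i).toForm p)

end Darboux

end PoissonCurl

/-! Both sides are compared after pairing with arbitrary covectors at a point. In a Darboux chart
the Liouville form has constant coefficients, so its curl operator is a plain divergence: the sum
over all coordinates `u` of `i(du) ∂_u A` (`curl_eq`). The reason is a degree count. A
`(k+1)`-vector wedged with `N - k` vectors vanishes in dimension `N`; contracting this zero with a
covector `ε` shows that `i(ε)` on the multivector corresponds to `ε ∧` on the contracted form
(`interiorProduct_contractCovector`). Summing over coordinates gives the exterior derivative, and
`interiorProduct_injective` then removes the volume form.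

On the other side, `D_η A` is the coordinate derivative of `A` along `♯η`, minus the derivation
induced by the Christoffel endomorphism `Γ_η` of the cotangent space (`pairing_onMultivector`).
Since `♯dyᵢ = ∂/∂xᵢ` and `♯dxᵢ = -∂/∂yᵢ`, the coordinate derivatives add up to exactly that
divergence, and the theorem amounts to the cancellation of the Christoffel terms.

Coordinate one-forms have vanishing bracket, so zero torsion gives `Γ_α β = Γ_β α`
(`christoffel_symm`). The Poisson tensor has constant coefficients, so `DΠ = 0` places every `Γ_α`
in the symplectic Lie algebra (`christoffel_symplectic`). In the slot contracted by `dxᵢ` or `dyᵢ`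
the two terms agree by symmetry. In any other slot, holding a covector `τ`, symmetry replaces
`Γ_{dyᵢ} τ` by `Γ_τ dyᵢ`, and likewise for `dxᵢ`; the sum over `i` is then, up to sign, a skew form
evaluated on `Γ_τ · ∑ dxᵢ ∧ dyᵢ`, which is zero because `Γ_τ` is infinitesimally symplectic
(`sum_skew_symplectic_eq_zero`, `sum_derivationAlt_eq_zero`). -/

namespace PoissonCurl

/-! ### Multivectors and contractions -/

section Multivectors

variable {V W : Type*} [AddCommGroup V] [Module ℝ V] [AddCommGroup W] [Module ℝ W]

/-- The pairing with a fixed `k`-vector, as an alternating map on covectors. -/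
def pairingAlt {k : ℕ} (A : ⋀[ℝ]^k V) : (Module.Dual ℝ V) [⋀^Fin k]→ₗ[ℝ] ℝ :=
  ((LinearMap.applyₗ A).comp (exteriorPower.pairingDual ℝ V k)).compAlternatingMap
    (exteriorPower.ιMulti ℝ k)

theorem pairingAlt_apply {k : ℕ} (A : ⋀[ℝ]^k V) (α : Fin k → Module.Dual ℝ V) :
    pairingAlt A α = pairing α A := rfl

/-- The pairing with fixed covectors, as a linear map on `k`-vectors. -/
def pairingLin {k : ℕ} (α : Fin k → Module.Dual ℝ V) : ⋀[ℝ]^k V →ₗ[ℝ] ℝ :=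
  exteriorPower.pairingDual ℝ V k (exteriorPower.ιMulti ℝ k α)

theorem pairingLin_apply {k : ℕ} (α : Fin k → Module.Dual ℝ V) (A : ⋀[ℝ]^k V) :
    pairingLin α A = pairing α A := rfl

theorem pairing_ιMulti {k : ℕ} (α : Fin k → Module.Dual ℝ V) (v : Fin k → V) :
    pairing α (exteriorPower.ιMulti ℝ k v) = (Matrix.of fun i j => α j (v i)).det :=
  exteriorPower.pairingDual_ιMulti_ιMulti α v

theorem pairing_map {k : ℕ} (f : V →ₗ[ℝ] W) (α : Fin k → Module.Dual ℝ W) (A : ⋀[ℝ]^k V) :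
    pairing α (exteriorPower.map k f A) = pairing (fun i => α i ∘ₗ f) A := by
  have : (pairingLin α).comp (exteriorPower.map k f) = pairingLin fun i => α i ∘ₗ f := by
    refine exteriorPower.linearMap_ext ?_
    ext v
    simp [pairingLin_apply, pairing_ιMulti, Function.comp_def]
  exact LinearMap.congr_fun this A

/-- The coordinates in the basis of the exterior power induced by a basis of `V` are themselves
pairings with dual basis covectors. -/
theorem pairing_ext [FiniteDimensional ℝ V] {k : ℕ} {A B : ⋀[ℝ]^k V}
    (h : ∀ α : Fin k → Module.Dual ℝ V, pairing α A = pairing α B) : A = B := by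
  refine (((Module.finBasis ℝ V).exteriorPower k).ext_elem) fun s => ?_
  rw [exteriorPower.basis_repr_apply, exteriorPower.basis_repr_apply]
  exact h _

/-- The witness has the values of `F` on increasing families of dual basis covectors as coordinates.
It supplies the existence that the choice in `onMultivector` depends on. -/
theorem exists_pairing_eq [FiniteDimensional ℝ V] {k : ℕ}
    (F : (Module.Dual ℝ V) [⋀^Fin k]→ₗ[ℝ] ℝ) : ∃ B : ⋀[ℝ]^k V, ∀ α, pairing α B = F α := by
  classical
  let b := Module.finBasis ℝ V
  let B : ⋀[ℝ]^k V := ∑ s, F (b.coord ∘ Set.powersetCard.ofFinEmbEquiv.symm s) •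
    b.exteriorPower k s
  refine ⟨B, fun α => ?_⟩
  have key : (LinearMap.applyₗ B).comp (exteriorPower.pairingDual ℝ V k)
      = exteriorPower.alternatingMapLinearEquiv F := by
    refine (b.dualBasis.exteriorPower k).ext fun s => ?_
    have hs : (b.dualBasis.exteriorPower k) s
        = exteriorPower.ιMulti ℝ k (b.coord ∘ Set.powersetCard.ofFinEmbEquiv.symm s) := by
      rw [exteriorPower.basis_apply, exteriorPower.ιMulti_family]
      congr 1
      ext i : 1
      simp [b.coe_dualBasis]
    rw [hs, exteriorPower.alternatingMapLinearEquiv_apply_ιMulti]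
    change exteriorPower.ιMultiDual ℝ k b s B = _
    rw [← exteriorPower.basis_repr_apply]
    simp [B, -exteriorPower.coe_basis, Module.Basis.repr_self, Finsupp.single_apply]
  have := LinearMap.congr_fun key (exteriorPower.ιMulti ℝ k α)
  rw [exteriorPower.alternatingMapLinearEquiv_apply_ιMulti] at this
  exact this

theorem removeNth_succ_eq_cons {n : ℕ} {X : Type*} (i : Fin (n + 1)) (v : Fin (n + 2) → X) :
    i.succ.removeNth v = Fin.cons (v 0) (i.removeNth (Fin.tail v)) := by
  ext j
  refine Fin.cases ?_ (fun j => ?_) j <;> simp [Fin.removeNth, Fin.tail]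

open CliffordAlgebra in
theorem contractLeft_ιMulti (ε : Module.Dual ℝ V) {n : ℕ} (v : Fin (n + 1) → V) :
    contractLeft (Q := (0 : QuadraticForm ℝ V)) ε (ExteriorAlgebra.ιMulti ℝ (n + 1) v) =
      ∑ i : Fin (n + 1), ((-1 : ℝ) ^ (i : ℕ) * ε (v i)) •
        ExteriorAlgebra.ιMulti ℝ n (i.removeNth v) := by
  induction n with
  | zero =>
    rw [ExteriorAlgebra.ιMulti_succ_apply]
    erw [contractLeft_ι_mul]
    simp only [ExteriorAlgebra.ιMulti_zero_apply]
    erw [contractLeft_one]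
    simp
  | succ n ih =>
    rw [ExteriorAlgebra.ιMulti_succ_apply]
    erw [contractLeft_ι_mul]
    conv_rhs => rw [Fin.sum_univ_succ]
    rw [show Matrix.vecTail v = Fin.tail v from rfl, ih, sub_eq_add_neg, Finset.mul_sum,
      ← Finset.sum_neg_distrib]
    congr 1
    · simp [Fin.removeNth_zero]
    · refine Finset.sum_congr rfl fun i _ => ?_
      rw [removeNth_succ_eq_cons, ExteriorAlgebra.ιMulti_succ_apply]
      rw [show Matrix.vecTail (Fin.cons (v 0) (i.removeNth (Fin.tail v)) : Fin (n + 1) → V)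
        = i.removeNth (Fin.tail v) from by ext; simp [Matrix.vecTail]]
      erw [mul_smul_comm]
      rw [← neg_smul]
      congr 1
      simp [Fin.tail, pow_succ]

-- The antiderivation rule for a product, with right contraction on the first factor and left
-- contraction on the second. The sign comes from moving `ε` past the `n` vectors, one per induction
-- step.
open CliffordAlgebra in
theorem contractRight_mul_ιMulti (ε : Module.Dual ℝ V) (X : ExteriorAlgebra ℝ V) {n : ℕ}
    (v : Fin n → V) :
    contractRight (Q := (0 : QuadraticForm ℝ V)) (X * ExteriorAlgebra.ιMulti ℝ n v) ε =
      (-1 : ℝ) ^ n • (contractRight (Q := (0 : QuadraticForm ℝ V)) X ε *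
          ExteriorAlgebra.ιMulti ℝ n v
        - X * contractLeft (Q := (0 : QuadraticForm ℝ V)) ε (ExteriorAlgebra.ιMulti ℝ n v)) := by
  induction n generalizing X with
  | zero =>
    simp only [ExteriorAlgebra.ιMulti_zero_apply, mul_one, pow_zero, one_smul]
    erw [contractLeft_one]
    simp
  | succ n ih =>
    rw [ExteriorAlgebra.ιMulti_succ_apply, ← mul_assoc, ih]
    erw [contractRight_mul_ι, contractLeft_ι_mul]
    rw [pow_succ, mul_smul]
    congr 1
    rw [neg_one_smul]
    simp only [sub_mul, mul_sub, smul_mul_assoc, mul_smul_comm, mul_assoc]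
    abel

theorem contractRight_ιMulti (ε : Module.Dual ℝ V) {n : ℕ} (v : Fin (n + 1) → V) :
    CliffordAlgebra.contractRight (Q := (0 : QuadraticForm ℝ V))
      (ExteriorAlgebra.ιMulti ℝ (n + 1) v) ε =
      ∑ i : Fin (n + 1), ((-1 : ℝ) ^ ((i : ℕ) + n) * ε (v i)) •
        ExteriorAlgebra.ιMulti ℝ n (i.removeNth v) := by
  have h := contractRight_mul_ιMulti ε 1 v
  rw [one_mul, one_mul, CliffordAlgebra.contractRight_one, zero_mul, zero_sub,
    contractLeft_ιMulti, smul_neg, ← neg_smul, Finset.smul_sum] at h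
  rw [h]
  refine Finset.sum_congr rfl fun i _ => ?_
  rw [smul_smul]
  congr 1
  ring

/-- On decomposable multivectors this is the Laplace expansion of the determinant along its last
column, the one belonging to `ε`. -/
theorem pairing_contractCovector {k : ℕ} (ε : Module.Dual ℝ V) (A : ⋀[ℝ]^(k + 1) V)
    (τ : Fin k → Module.Dual ℝ V) :
    pairing τ (contractCovector ε A)
      = pairing (Fin.snoc τ ε : Fin (k + 1) → Module.Dual ℝ V) A := by
  let c : ⋀[ℝ]^(k + 1) V →ₗ[ℝ] ⋀[ℝ]^k V :=
    { toFun := contractCovector ε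
      map_add' := fun x y => Subtype.ext (by simp [contractCovector])
      map_smul' := fun r x => Subtype.ext (by simp [contractCovector]) }
  have : (pairingLin τ).comp c = pairingLin (Fin.snoc τ ε : Fin (k + 1) → Module.Dual ℝ V) := by
    refine exteriorPower.linearMap_ext ?_
    ext v
    have hc : c (exteriorPower.ιMulti ℝ (k + 1) v) = ∑ i : Fin (k + 1),
        ((-1 : ℝ) ^ ((i : ℕ) + k) * ε (v i)) • exteriorPower.ιMulti ℝ k (i.removeNth v) := by
      refine Subtype.ext ?_
      refine (contractRight_ιMulti ε v).trans ?_
      rw [AddSubmonoidClass.coe_finsetSum]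
      rfl
    simp only [LinearMap.compAlternatingMap_apply, LinearMap.comp_apply, hc, map_sum, map_smul,
      pairingLin_apply, pairing_ιMulti]
    rw [Matrix.det_succ_column _ (Fin.last k)]
    refine Finset.sum_congr rfl fun i _ => ?_
    simp [Fin.removeNth, Matrix.submatrix, mul_assoc]
  exact LinearMap.congr_fun this A

/-- `i(A)η` as a linear function of `A`. -/
theorem interiorProduct_apply {N a b : ℕ} (η : V [⋀^Fin N]→ₗ[ℝ] ℝ) (A : ⋀[ℝ]^a V)
    (v : Fin b → V) :
    interiorProduct η A v = ExteriorAlgebra.liftAlternating (R := ℝ) (Pi.single N η)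
      ((A : ExteriorAlgebra ℝ V) * ExteriorAlgebra.ιMulti ℝ b v) := rfl

theorem interiorProduct_add {N a b : ℕ} (η : V [⋀^Fin N]→ₗ[ℝ] ℝ) (A B : ⋀[ℝ]^a V) :
    (interiorProduct η (A + B) : V [⋀^Fin b]→ₗ[ℝ] ℝ)
      = interiorProduct η A + interiorProduct η B := by
  ext v
  simp [interiorProduct_apply, add_mul]

theorem interiorProduct_smul {N a b : ℕ} (η : V [⋀^Fin N]→ₗ[ℝ] ℝ) (c : ℝ) (A : ⋀[ℝ]^a V) :
    (interiorProduct η (c • A) : V [⋀^Fin b]→ₗ[ℝ] ℝ) = c • interiorProduct η A := by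
  ext v
  simp [interiorProduct_apply]

theorem coe_exteriorPower_map {a : ℕ} (f : V →ₗ[ℝ] W) (A : ⋀[ℝ]^a V) :
    ((exteriorPower.map a f A : ⋀[ℝ]^a W) : ExteriorAlgebra ℝ W) = ExteriorAlgebra.map f A := by
  have : (Submodule.subtype _).comp (exteriorPower.map a f)
      = (ExteriorAlgebra.map f).toLinearMap.comp (Submodule.subtype _) := by
    refine exteriorPower.linearMap_ext ?_
    ext v
    simp
  exact LinearMap.congr_fun this A

/-- The functionals on the exterior algebra attached to `η` and to its pullback differ by the
algebra map induced by `f`, as is seen degree by degree on products of vectors. This naturality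
carries contractions through charts. -/
theorem interiorProduct_compLinearMap {N a b : ℕ} (η : W [⋀^Fin N]→ₗ[ℝ] ℝ) (f : V →ₗ[ℝ] W)
    (A : ⋀[ℝ]^a V) :
    (interiorProduct (η.compLinearMap f) A : V [⋀^Fin b]→ₗ[ℝ] ℝ)
      = (interiorProduct η (exteriorPower.map a f A)).compLinearMap f := by
  have : ExteriorAlgebra.liftAlternating (R := ℝ) (Pi.single N (η.compLinearMap f))
      = (ExteriorAlgebra.liftAlternating (R := ℝ) (Pi.single N η)).comp
        (ExteriorAlgebra.map f).toLinearMap := by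
    ext i v
    simp only [LinearMap.compAlternatingMap_apply, ExteriorAlgebra.liftAlternating_apply_ιMulti,
      LinearMap.comp_apply, AlgHom.toLinearMap_apply, ExteriorAlgebra.map_apply_ιMulti]
    by_cases h : i = N
    · subst h
      simp [Function.comp_def]
    · simp [Pi.single_eq_of_ne h]
  ext v
  rw [interiorProduct_apply, this]
  simp [interiorProduct_apply, coe_exteriorPower_map, Function.comp_def]

theorem mul_ιMulti_mem {a b : ℕ} (A : ⋀[ℝ]^a V) (v : Fin b → V) :
    (A : ExteriorAlgebra ℝ V) * ExteriorAlgebra.ιMulti ℝ b v ∈ ⋀[ℝ]^(a + b) V := by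
  have h := Submodule.mul_mem_mul A.2 (ExteriorAlgebra.ιMulti_range ℝ b ⟨v, rfl⟩)
  rwa [← pow_add] at h

theorem exteriorPower_eq_zero_of_finrank_lt [FiniteDimensional ℝ V] {n : ℕ}
    (hn : Module.finrank ℝ V < n) {x : ExteriorAlgebra ℝ V} (hx : x ∈ ⋀[ℝ]^n V) : x = 0 := by
  have h0 : Module.finrank ℝ (⋀[ℝ]^n V) = 0 := by
    rw [exteriorPower.finrank_eq, Nat.choose_eq_zero_of_lt hn]
  have := Module.finrank_zero_iff.mp h0
  exact congrArg Subtype.val (Subsingleton.elim (⟨x, hx⟩ : ⋀[ℝ]^n V) 0)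

/-- In top degree, contraction of the multivector by a covector `ε` is dual to exterior
multiplication of the contracted form by `ε`. -/
theorem interiorProduct_contractCovector [FiniteDimensional ℝ V] {N k b : ℕ}
    (hN : Module.finrank ℝ V < k + 1 + (b + 1)) (η : V [⋀^Fin N]→ₗ[ℝ] ℝ) (ε : Module.Dual ℝ V)
    (X : ⋀[ℝ]^(k + 1) V) (v : Fin (b + 1) → V) :
    interiorProduct η (contractCovector ε X) v =
      ∑ i : Fin (b + 1), (-1 : ℝ) ^ (i : ℕ) * ε (v i) *
        interiorProduct η X (i.removeNth v) := by
  -- The product of `X` with the `b + 1` vectors exceeds the dimension and is zero, so the two terms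
  -- of the antiderivation rule coincide.
  have h := contractRight_mul_ιMulti ε X.1 v
  rw [exteriorPower_eq_zero_of_finrank_lt hN (mul_ιMulti_mem X v), map_zero,
    LinearMap.zero_apply, eq_comm, smul_eq_zero_iff_right (by simp), sub_eq_zero] at h
  rw [interiorProduct_apply]
  change ExteriorAlgebra.liftAlternating (R := ℝ) (Pi.single N η)
    (CliffordAlgebra.contractRight (Q := (0 : QuadraticForm ℝ V)) X.1 ε *
      ExteriorAlgebra.ιMulti ℝ (b + 1) v) = _
  rw [h, contractLeft_ιMulti]
  simp only [Finset.mul_sum, map_sum, mul_smul_comm, map_smul, interiorProduct_apply, smul_eq_mul]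

end Multivectors

/-! ### Volume forms, wedge powers of two-forms, and derivations of alternating maps -/

section VolumeForms

variable {V W : Type*} [AddCommGroup V] [Module ℝ V] [AddCommGroup W] [Module ℝ W]

theorem alternatingMap_sum_apply {ι κ M : Type*} [AddCommGroup M] [Module ℝ M] (s : Finset ι)
    (f : ι → V [⋀^κ]→ₗ[ℝ] M) (v : κ → V) : (∑ i ∈ s, f i) v = ∑ i ∈ s, f i v :=
  map_sum (⟨⟨fun g : V [⋀^κ]→ₗ[ℝ] M => g v, rfl⟩, fun _ _ => rfl⟩ : _ →+ M) _ _

/-- Evaluating `i(A)η` on the basis vectors indexed by the complement of `s` isolates the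
`s`-coordinate of `A`: any other index set of size `k` meets that complement and repeats a vector,
while `s` itself yields `η` on a permuted basis. -/
theorem interiorProduct_injective {N k b : ℕ} (v : Module.Basis (Fin N) ℝ V)
    (hkb : k + b = N) {η : V [⋀^Fin N]→ₗ[ℝ] ℝ} (hη : η ≠ 0) :
    Function.Injective fun A : ⋀[ℝ]^k V => (interiorProduct η A : V [⋀^Fin b]→ₗ[ℝ] ℝ) := by
  classical
  subst hkb
  let L : ⋀[ℝ]^k V →ₗ[ℝ] V [⋀^Fin b]→ₗ[ℝ] ℝ :=
    { toFun := fun A => interiorProduct η A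
      map_add' := interiorProduct_add η
      map_smul' := fun c A => interiorProduct_smul η c A }
  change Function.Injective L
  rw [injective_iff_map_eq_zero]
  intro A hA
  refine (v.exteriorPower k).ext_elem fun s => ?_
  rw [map_zero, Finsupp.zero_apply]
  have hcard : (s.valᶜ).card = b := by
    rw [Finset.card_compl, Fintype.card_fin, s.prop, Nat.add_sub_cancel_left]
  let t : Set.powersetCard (Fin (k + b)) b := ⟨s.valᶜ, hcard⟩
  let et := Set.powersetCard.ofFinEmbEquiv.symm t
  have hval : ∀ u : Set.powersetCard (Fin (k + b)) k, L (v.exteriorPower k u) (v ∘ et) =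
      η (v ∘ Fin.append (Set.powersetCard.ofFinEmbEquiv.symm u) et) := by
    intro u
    change interiorProduct η _ _ = _
    rw [interiorProduct_apply, exteriorPower.basis_apply, exteriorPower.ιMulti_family,
      exteriorPower.ιMulti_apply_coe, ExteriorAlgebra.ιMulti_mul_ιMulti,
      ExteriorAlgebra.liftAlternating_apply_ιMulti, Pi.single_eq_same]
    congr 1
    ext i : 1
    refine Fin.addCases (fun i => ?_) (fun i => ?_) i <;> simp
  have hne : ∀ u : Set.powersetCard (Fin (k + b)) k, u ≠ s →
      L (v.exteriorPower k u) (v ∘ et) = 0 := by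
    intro u hu
    rw [hval]
    obtain ⟨i, hiu, his⟩ := (Set.powersetCard.exists_mem_notMem_iff_ne u s).mp hu
    obtain ⟨a, ha⟩ := (Set.powersetCard.mem_range_ofFinEmbEquiv_symm_iff_mem u i).mpr hiu
    obtain ⟨c, hc⟩ := (Set.powersetCard.mem_range_ofFinEmbEquiv_symm_iff_mem t i).mpr
      (show i ∈ s.valᶜ from Finset.mem_compl.mpr his)
    refine η.map_eq_zero_of_eq _ (i := Fin.castAdd b a) (j := Fin.natAdd k c) ?_ ?_
    · simp [ha, hc, et]
    · intro h
      have := congrArg Fin.val h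
      simp at this
      omega
  have hs : L (v.exteriorPower k s) (v ∘ et) ≠ 0 := by
    rw [hval]
    have hinj : Function.Injective (Fin.append (Set.powersetCard.ofFinEmbEquiv.symm s) et) := by
      have hdis : ∀ a c, Set.powersetCard.ofFinEmbEquiv.symm s a ≠ et c := by
        intro a c h
        have h1 : Set.powersetCard.ofFinEmbEquiv.symm s a ∈ s :=
          (Set.powersetCard.mem_range_ofFinEmbEquiv_symm_iff_mem s _).mp ⟨a, rfl⟩
        have h2 : et c ∈ t :=
          (Set.powersetCard.mem_range_ofFinEmbEquiv_symm_iff_mem t _).mp ⟨c, rfl⟩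
        rw [← h] at h2
        exact (Finset.mem_compl.mp (show _ ∈ s.valᶜ from h2)) h1
      exact Fin.append_injective_iff.mpr ⟨(Set.powersetCard.ofFinEmbEquiv.symm s).injective,
        et.injective, hdis⟩
    have hbij := Finite.injective_iff_bijective.mp hinj
    have := (η.map_basis_ne_zero_iff (v.reindex (Equiv.ofBijective _ hbij).symm)).mpr hη
    simpa [Function.comp_def] using this
  have hsum := (v.exteriorPower k).sum_repr A
  have h0 : L A (v ∘ et) = 0 := by rw [hA]; rfl
  rw [← hsum, map_sum, alternatingMap_sum_apply, Finset.sum_eq_single s] at h0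
  · rw [map_smul, AlternatingMap.smul_apply, smul_eq_mul] at h0
    exact (mul_eq_zero.mp h0).resolve_right hs
  · intro u _ hu
    rw [map_smul, AlternatingMap.smul_apply, hne u hu, smul_zero]
  · simp

theorem interiorProductInv_interiorProduct {N k b : ℕ} (v : Module.Basis (Fin N) ℝ V)
    (hkb : k + b = N) {η : V [⋀^Fin N]→ₗ[ℝ] ℝ} (hη : η ≠ 0) (A : ⋀[ℝ]^k V) :
    interiorProductInv η (interiorProduct η A : V [⋀^Fin b]→ₗ[ℝ] ℝ) = A :=
  Function.leftInverse_invFun (interiorProduct_injective v hkb hη) A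

theorem wedge_compLinearMap {k l : ℕ} (a : W [⋀^Fin k]→ₗ[ℝ] ℝ) (b : W [⋀^Fin l]→ₗ[ℝ] ℝ)
    (f : V →ₗ[ℝ] W) :
    wedge (a.compLinearMap f) (b.compLinearMap f) = (wedge a b).compLinearMap f := by
  have : (a.compLinearMap f).domCoprod (b.compLinearMap f) = (a.domCoprod b).compLinearMap f := by
    ext v
    simp only [AlternatingMap.domCoprod_apply, AlternatingMap.compLinearMap_apply,
      sum_apply]
    refine Finset.sum_congr rfl fun σ _ => ?_
    induction σ using Quotient.inductionOn' with
    | h σ => simp [AlternatingMap.domCoprod.summand_mk'']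
  ext v
  simp only [wedge, this]
  rfl

theorem wedgePow_compLinearMap (σ : W [⋀^Fin 2]→ₗ[ℝ] ℝ) (f : V →ₗ[ℝ] W) (j : ℕ) :
    wedgePow (σ.compLinearMap f) j = (wedgePow σ j).compLinearMap f := by
  induction j with
  | zero => rfl
  | succ j ih => rw [wedgePow, wedgePow, ih, wedge_compLinearMap]

theorem wedge_sum_left {ι : Type*} (s : Finset ι) {k l : ℕ} (a : ι → V [⋀^Fin k]→ₗ[ℝ] ℝ)
    (b : V [⋀^Fin l]→ₗ[ℝ] ℝ) : wedge (∑ i ∈ s, a i) b = ∑ i ∈ s, wedge (a i) b := by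
  ext v
  simp only [wedge, ← AlternatingMap.domCoprod'_apply, TensorProduct.sum_tmul, map_sum,
    alternatingMap_sum_apply,
    LinearMap.compAlternatingMap_apply, AlternatingMap.domDomCongr_apply, map_sum]

theorem wedge_sum_right {ι : Type*} (s : Finset ι) {k l : ℕ} (a : V [⋀^Fin k]→ₗ[ℝ] ℝ)
    (b : ι → V [⋀^Fin l]→ₗ[ℝ] ℝ) : wedge a (∑ i ∈ s, b i) = ∑ i ∈ s, wedge a (b i) := by
  ext v
  simp only [wedge, ← AlternatingMap.domCoprod'_apply, TensorProduct.tmul_sum, map_sum,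
    alternatingMap_sum_apply,
    LinearMap.compAlternatingMap_apply, AlternatingMap.domDomCongr_apply, map_sum]

/-- The product `v ↦ ∏ᵢ αᵢ(vᵢ)` of covectors. -/
def covectorProd {ι : Type*} [Fintype ι] (α : ι → Module.Dual ℝ V) :
    MultilinearMap ℝ (fun _ : ι => V) ℝ :=
  (MultilinearMap.mkPiAlgebra ℝ ι ℝ).compLinearMap α

/-- The wedge product `α₁ ∧ ⋯ ∧ αₖ` of covectors. -/
def covectorWedge {ι : Type*} [Fintype ι] [DecidableEq ι] (α : ι → Module.Dual ℝ V) :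
    V [⋀^ι]→ₗ[ℝ] ℝ :=
  MultilinearMap.alternatization (covectorProd α)

theorem covectorWedge_apply {ι : Type*} [Fintype ι] [DecidableEq ι] (α : ι → Module.Dual ℝ V)
    (v : ι → V) : covectorWedge α v = (Matrix.of fun j i => α i (v j)).det := by
  rw [Matrix.det_apply, covectorWedge, MultilinearMap.alternatization_apply]
  simp [covectorProd]

/-- Alternatization takes the tensor product of multilinear maps to the shuffle product of their
alternatizations, so the claim reduces to products of covectors. -/
theorem wedge_covectorWedge {k l : ℕ} (α : Fin k → Module.Dual ℝ V) (β : Fin l → Module.Dual ℝ V) :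
    wedge (covectorWedge α) (covectorWedge β) = covectorWedge (Fin.append α β) := by
  ext v
  have h : (LinearMap.mul' ℝ ℝ).compMultilinearMap
      ((covectorProd α).domCoprod (covectorProd β)) = covectorProd (Sum.elim α β) := by
    ext w
    simp [covectorProd, MultilinearMap.domCoprod_apply]
  have h2 : (LinearMap.mul' ℝ ℝ).compAlternatingMap
      ((covectorWedge α).domCoprod (covectorWedge β)) = covectorWedge (Sum.elim α β) := by
    rw [covectorWedge, covectorWedge, ← MultilinearMap.domCoprod_alternization,
      ← LinearMap.compMultilinearMap_alternatization, h, covectorWedge]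
  rw [wedge, h2, AlternatingMap.domDomCongr_apply, covectorWedge_apply, covectorWedge_apply,
    ← Matrix.det_reindex_self finSumFinEquiv]
  congr 1
  ext i j
  simp only [Matrix.reindex_apply, Matrix.submatrix_apply, Matrix.of_apply, Function.comp_apply,
    Equiv.apply_symm_apply]
  refine Fin.addCases (fun j => ?_) (fun j => ?_) j <;> simp

/-- The family `x₀, y₀, x₁, y₁, …`, the pairs being chosen by `r`. -/
def interleave {X : Type*} {m j : ℕ} (x y : Fin m → X) (r : Fin j → Fin m) (t : Fin (2 * j)) : X :=
  if (t : ℕ) % 2 = 0 then x (r ⟨t / 2, by omega⟩) else y (r ⟨t / 2, by omega⟩)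

theorem append_interleave {X : Type*} {m j : ℕ} (x y : Fin m → X) (r : Fin j → Fin m) (i : Fin m) :
    Fin.append (interleave x y r) ![x i, y i]
      = interleave x y (Fin.snoc r i : Fin (j + 1) → Fin m) := by
  ext t
  refine Fin.addCases (fun t => ?_) (fun t => ?_) t
  · have ht : (t : ℕ) / 2 < j := by omega
    simp [interleave, Fin.snoc, ht]
  · have h1 : (2 * j + (t : ℕ)) / 2 = j := by omega
    have h2 : (2 * j + (t : ℕ)) % 2 = t := by omega
    rw [Fin.append_right]
    simp only [interleave, Fin.val_natAdd, h1, h2, Fin.snoc]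
    fin_cases t <;> simp

/-- The power is expanded over all choices `r` of one summand per factor, repetitions included. -/
theorem wedgePow_sum_covectorWedge {m : ℕ} (x y : Fin m → Module.Dual ℝ V) (j : ℕ) :
    wedgePow (∑ i, covectorWedge ![x i, y i]) j
      = ∑ r : Fin j → Fin m, covectorWedge (interleave x y r) := by
  induction j with
  | zero =>
    rw [Fintype.sum_unique (ι := Fin 0 → Fin m)]
    ext v
    rw [covectorWedge_apply]
    simp [wedgePow]
  | succ j ih =>
    rw [wedgePow, ih, wedge_sum_left]
    simp_rw [wedge_sum_right, wedge_covectorWedge, append_interleave]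
    rw [← Fintype.sum_prod_type']
    refine Fintype.sum_equiv ((Equiv.prodComm _ _).trans (Fin.snocEquiv fun _ => Fin m)) _ _ ?_
    rintro ⟨r, i⟩
    rfl

/-- On the interleaved vectors `u₀, w₀, u₁, w₁, …` the term of a choice `r` is the determinant of
the Kronecker product of a 0-1 matrix `R r` with the 2 by 2 identity, that is `(R r).det ^ 2`. A sum
of squares has no cancellation, and `r = id` contributes 1. -/
theorem wedgePow_ne_zero {m : ℕ} (x y : Fin m → Module.Dual ℝ V) (u w : Fin m → V)
    (hxu : ∀ i j, x i (u j) = if i = j then 1 else 0) (hxw : ∀ i j, x i (w j) = 0)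
    (hyu : ∀ i j, y i (u j) = 0) (hyw : ∀ i j, y i (w j) = if i = j then 1 else 0) :
    wedgePow (∑ i, covectorWedge ![x i, y i]) m ≠ 0 := by
  intro h0
  let R : (Fin m → Fin m) → Matrix (Fin m) (Fin m) ℝ := fun r => Matrix.of fun j i =>
    if r i = j then 1 else 0
  let e : Fin (2 * m) ≃ Fin m × Fin 2 := (finCongr (mul_comm 2 m)).trans finProdFinEquiv.symm
  have hdet : ∀ r, covectorWedge (interleave x y r) (interleave u w id) = (R r).det ^ 2 := by
    intro r
    have hM : (Matrix.of fun j i => interleave x y r i (interleave u w id j))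
        = (Matrix.kroneckerMap (· * ·) (R r) (1 : Matrix (Fin 2) (Fin 2) ℝ)).submatrix e e := by
      ext j i
      have hi := Nat.mod_two_eq_zero_or_one (i : ℕ)
      have hj := Nat.mod_two_eq_zero_or_one (j : ℕ)
      rcases hi with hi | hi <;> rcases hj with hj | hj <;>
        simp [interleave, hi, hj, hxu, hxw, hyu, hyw, R, e, Fin.ext_iff,
          Fin.divNat, Fin.modNat]
    rw [covectorWedge_apply, hM, Matrix.det_submatrix_equiv_self, Matrix.det_kronecker]
    simp
  have h1 := DFunLike.congr_fun h0 (interleave u w id)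
  rw [wedgePow_sum_covectorWedge, alternatingMap_sum_apply] at h1
  simp only [hdet, AlternatingMap.zero_apply] at h1
  have h2 := (Finset.sum_eq_zero_iff_of_nonneg fun r _ => sq_nonneg (R r).det).mp h1 id
    (Finset.mem_univ _)
  have h3 : R id = 1 := by
    ext i j
    simp [R, Matrix.one_apply, eq_comm]
  simp [h3] at h2

/-- The derivation `a ↦ ∑ᵢ M(a₁, …, G aᵢ, …, aₖ)` induced by an endomorphism on alternating maps. -/
def derivationAlt {k : ℕ} (M : V [⋀^Fin k]→ₗ[ℝ] ℝ) (G : V →ₗ[ℝ] V) : V [⋀^Fin k]→ₗ[ℝ] ℝ :=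
  { ∑ i, M.toMultilinearMap.compLinearMap (Function.update (fun _ => LinearMap.id) i G) with
    map_eq_zero_of_eq' := fun a p q hpq hne => by
      have hup : ∀ i, (fun j => (Function.update (fun _ => LinearMap.id) i G :
          Fin k → V →ₗ[ℝ] V) j (a j)) = Function.update a i (G (a i)) := by
        intro i
        ext j
        by_cases h : j = i
        · subst h; simp
        · simp [h]
      change (∑ i, M.toMultilinearMap.compLinearMap
        (Function.update (fun _ => LinearMap.id) i G)) a = 0
      rw [sum_apply]
      simp only [MultilinearMap.compLinearMap_apply, hup]
      -- When arguments `p` and `q` agree, every term modifying a third slot vanishes, and the two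
      -- remaining terms differ by a transposition.
      rw [Finset.sum_eq_add p q hne]
      · have hswap : Function.update a q (G (a q)) =
            Function.update a p (G (a p)) ∘ Equiv.swap p q := by
          ext j
          by_cases hp : j = p
          · subst hp; simp [hne, hne.symm, hpq]
          · by_cases hq : j = q
            · subst hq; simp [hpq]
            · simp [Equiv.swap_apply_of_ne_of_ne hp hq, hp, hq]
        rw [hswap]
        exact (congrArg _ (M.map_swap _ hne)).trans (add_neg_cancel _)
      · intro i _ hi
        refine M.map_eq_zero_of_eq _ ?_ hne
        simp [hi.1.symm, hi.2.symm, hpq]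
      · simp
      · simp }

theorem derivationAlt_apply {k : ℕ} (M : V [⋀^Fin k]→ₗ[ℝ] ℝ) (G : V →ₗ[ℝ] V) (a : Fin k → V) :
    derivationAlt M G a = ∑ i, M (Function.update a i (G (a i))) := by
  change (∑ i, M.toMultilinearMap.compLinearMap
    (Function.update (fun _ => LinearMap.id) i G)) a = _
  rw [sum_apply]
  refine Finset.sum_congr rfl fun i _ => congrArg M ?_
  ext j
  by_cases h : j = i
  · subst h; simp
  · simp [h]

/-- An infinitesimally symplectic endomorphism, contracted with the Poisson tensor, pairs trivially
with every skew form. -/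
theorem sum_skew_symplectic_eq_zero {m : ℕ} (x y : Fin m → V) (G : V →ₗ[ℝ] V)
    (K : V →ₗ[ℝ] V →ₗ[ℝ] ℝ) (hK : ∀ a b, K a b = -K b a) (S Q R : Fin m → Fin m → ℝ)
    (hS : ∀ i j, S i j = S j i) (hR : ∀ i j, R i j = R j i)
    (hy : ∀ i, G (y i) = ∑ j, (S i j • x j - Q i j • y j))
    (hx : ∀ i, G (x i) = ∑ j, (Q j i • x j - R i j • y j)) :
    ∑ i, (K (G (y i)) (x i) - K (G (x i)) (y i)) = 0 := by
  -- A symmetric array summed against a skew form equals its own negative; this disposes of the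
  -- blocks `S` and `R`.
  have hsym : ∀ (T : Fin m → Fin m → ℝ) (z : Fin m → V), (∀ i j, T i j = T j i) →
      ∑ i, ∑ j, T i j * K (z j) (z i) = 0 := by
    intro T z hT
    have : ∑ i, ∑ j, T i j * K (z j) (z i) = -∑ i, ∑ j, T i j * K (z j) (z i) := by
      conv_lhs => rw [Finset.sum_comm]
      simp_rw [← Finset.sum_neg_distrib]
      refine Finset.sum_congr rfl fun i _ => Finset.sum_congr rfl fun j _ => ?_
      rw [hT, hK]
      ring
    linarith
  -- The diagonal blocks of a symplectic endomorphism are negative transposes of each other, so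
  -- their contributions match after exchanging the summation indices.
  have hmix : ∑ i, ∑ j, Q j i * K (x j) (y i) = -∑ i, ∑ j, Q i j * K (y j) (x i) := by
    rw [Finset.sum_comm]
    simp_rw [← Finset.sum_neg_distrib]
    refine Finset.sum_congr rfl fun i _ => Finset.sum_congr rfl fun j _ => ?_
    rw [hK]
    ring
  have h1 := hsym S x hS
  have h2 := hsym R y hR
  simp only [hx, hy, map_sum, map_sub, map_smul, LinearMap.sum_apply, LinearMap.sub_apply,
    LinearMap.smul_apply, smul_eq_mul, Finset.sum_sub_distrib]
  linarith

end VolumeForms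

/-! ### Independence of charts: forms, smoothness, exterior derivative -/

section Charts

theorem eventually_mem_transition {E P : Type*} [TopologicalSpace E] [TopologicalSpace P]
    {e e' : OpenPartialHomeomorph P E} {p : P} (hp : p ∈ e.source) (hp' : p ∈ e'.source) :
    ∀ᶠ y in 𝓝 (e p), y ∈ e.target ∧ e.symm y ∈ e'.source := by
  refine (e.open_target.eventually_mem (e.map_source hp)).and ?_
  refine (e.continuousAt_symm (e.map_source hp)).eventually_mem ?_
  rw [e.left_inv hp]
  exact e'.open_source.mem_nhds hp'

variable {E : Type*} [NormedAddCommGroup E] [NormedSpace ℝ E]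
  {P : Type*} [TopologicalSpace P] [ChartedSpace E P]

/-- The expression of a one-form in a chart. -/
def OneForm.inChart (α : OneForm E P) (e : OpenPartialHomeomorph P E) : E → (E →L[ℝ] ℝ) := fun y =>
  (α (e.symm y)).comp (mfderiv 𝓘(ℝ, E) 𝓘(ℝ, E) e.symm y : E →L[ℝ] TangentSpace 𝓘(ℝ, E) (e.symm y))

theorem two_le_infty : (2 : WithTop ℕ∞) ≤ ∞ := WithTop.coe_le_coe.mpr le_top

variable {e e' : OpenPartialHomeomorph P E}

theorem mdifferentiable_of_mem_maximalAtlas (he : e ∈ IsManifold.maximalAtlas 𝓘(ℝ, E) ∞ P) :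
    e.MDifferentiable 𝓘(ℝ, E) 𝓘(ℝ, E) :=
  ⟨(contMDiffOn_of_mem_maximalAtlas he).mdifferentiableOn (by simp),
    (contMDiffOn_symm_of_mem_maximalAtlas he).mdifferentiableOn (by simp)⟩

/-- The differential of a chart. -/
def chartEquiv (he : e ∈ IsManifold.maximalAtlas 𝓘(ℝ, E) ∞ P) {p : P} (hp : p ∈ e.source) :
    TangentSpace 𝓘(ℝ, E) p ≃L[ℝ] E :=
  (mdifferentiable_of_mem_maximalAtlas he).mfderiv hp

theorem contDiffAt_transition (he : e ∈ IsManifold.maximalAtlas 𝓘(ℝ, E) ∞ P)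
    (he' : e' ∈ IsManifold.maximalAtlas 𝓘(ℝ, E) ∞ P) {y : E} (hy : y ∈ e.target)
    (hy' : e.symm y ∈ e'.source) : ContDiffAt ℝ ∞ (e' ∘ e.symm) y := by
  rw [← contMDiffAt_iff_contDiffAt]
  exact (contMDiffAt_of_mem_maximalAtlas he' hy').comp y
    (contMDiffAt_symm_of_mem_maximalAtlas he hy)

/-- The chain rule for the transition map, solved for the differential of `e.symm` by inverting the
differential of `e'`. -/
theorem mfderiv_symm_transition (he : e ∈ IsManifold.maximalAtlas 𝓘(ℝ, E) ∞ P)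
    (he' : e' ∈ IsManifold.maximalAtlas 𝓘(ℝ, E) ∞ P) {q : P} (hq : q ∈ e.source)
    (hq' : q ∈ e'.source) {τ' : E →L[ℝ] E} (hτ' : τ' = fderiv ℝ (e' ∘ e.symm) (e q)) :
    (mfderiv 𝓘(ℝ, E) 𝓘(ℝ, E) e.symm (e q) : E →L[ℝ] TangentSpace 𝓘(ℝ, E) q) =
      (mfderiv 𝓘(ℝ, E) 𝓘(ℝ, E) e'.symm (e' q) : E →L[ℝ] TangentSpace 𝓘(ℝ, E) q).comp τ' := by
  have h1 : τ' = (mfderiv 𝓘(ℝ, E) 𝓘(ℝ, E) e' q : TangentSpace 𝓘(ℝ, E) q →L[ℝ] E).comp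
        (mfderiv 𝓘(ℝ, E) 𝓘(ℝ, E) e.symm (e q) : E →L[ℝ] TangentSpace 𝓘(ℝ, E) q) := by
    rw [hτ', ← mfderiv_eq_fderiv]
    have := mfderiv_comp (I := 𝓘(ℝ, E)) (I' := 𝓘(ℝ, E)) (I'' := 𝓘(ℝ, E)) (e q)
      (show MDifferentiableAt 𝓘(ℝ, E) 𝓘(ℝ, E) e' (e.symm (e q)) from
        (mdifferentiable_of_mem_maximalAtlas he').mdifferentiableAt (by rwa [e.left_inv hq]))
      ((mdifferentiable_of_mem_maximalAtlas he).mdifferentiableAt_symm (e.map_source hq))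
    rw [this]
    congr 1
    rw [e.left_inv hq]
  rw [h1]
  ext v
  exact ((chartEquiv he' hq').symm_apply_apply _).symm

theorem Form.inChart_eventuallyEq [FiniteDimensional ℝ E] {k : ℕ} (η : Form E P k)
    (he : e ∈ IsManifold.maximalAtlas 𝓘(ℝ, E) ∞ P)
    (he' : e' ∈ IsManifold.maximalAtlas 𝓘(ℝ, E) ∞ P) {p : P} (hp : p ∈ e.source)
    (hp' : p ∈ e'.source) :
    η.inChart e =ᶠ[𝓝 (e p)] fun y => (η.inChart e' ((e' ∘ e.symm) y)).compContinuousLinearMap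
      (fderiv ℝ (e' ∘ e.symm) y) := by
  filter_upwards [eventually_mem_transition hp hp'] with y hy
  obtain ⟨q, hq, rfl⟩ : ∃ q ∈ e.source, e q = y := ⟨_, e.map_target hy.1, e.right_inv hy.1⟩
  rw [e.left_inv hq] at hy
  have h := mfderiv_symm_transition he he' hq hy.2 rfl
  ext v
  simp only [Form.inChart, Function.comp_apply]
  change η (e.symm (e q)) (fun i => mfderiv 𝓘(ℝ, E) 𝓘(ℝ, E) e.symm (e q) (v i)) =
    η (e'.symm (e' (e.symm (e q)))) (fun i => mfderiv 𝓘(ℝ, E) 𝓘(ℝ, E) e'.symm (e' (e.symm (e q)))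
      (fderiv ℝ (e' ∘ e.symm) (e q) (v i)))
  -- The tangent spaces at `q` and at `e.symm (e q)` are formally different types. The base points
  -- are therefore generalized to variables equal to `q`, after which substitution is allowed.
  have key : ∀ q1, q1 = q → ∀ q2, q2 = q →
      η q1 (fun i => (mfderiv 𝓘(ℝ, E) 𝓘(ℝ, E) e.symm (e q) : E → E) (v i)) =
      η q2 (fun i => (mfderiv 𝓘(ℝ, E) 𝓘(ℝ, E) e'.symm (e' q1) : E → E)
      (fderiv ℝ (e' ∘ e.symm) (e q) (v i))) := by
    rintro q1 rfl q2 rfl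
    exact congrArg _ (funext fun i => DFunLike.congr_fun h (v i))
  refine key _ (e.left_inv hq) _ ?_
  rw [e.left_inv hq, e'.left_inv hy.2]

theorem OneForm.inChart_eventuallyEq (α : OneForm E P)
    (he : e ∈ IsManifold.maximalAtlas 𝓘(ℝ, E) ∞ P)
    (he' : e' ∈ IsManifold.maximalAtlas 𝓘(ℝ, E) ∞ P) {p : P} (hp : p ∈ e.source)
    (hp' : p ∈ e'.source) :
    α.inChart e =ᶠ[𝓝 (e p)] fun y => (α.inChart e' ((e' ∘ e.symm) y)).comp
      (fderiv ℝ (e' ∘ e.symm) y) := by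
  filter_upwards [eventually_mem_transition hp hp'] with y hy
  obtain ⟨q, hq, rfl⟩ : ∃ q ∈ e.source, e q = y := ⟨_, e.map_target hy.1, e.right_inv hy.1⟩
  rw [e.left_inv hq] at hy
  have h := mfderiv_symm_transition he he' hq hy.2 rfl
  ext v
  simp only [OneForm.inChart, Function.comp_apply]
  have key : ∀ q1, q1 = q → ∀ q2, q2 = q →
      α q1 ((mfderiv 𝓘(ℝ, E) 𝓘(ℝ, E) e.symm (e q) : E → E) v) =
      α q2 ((mfderiv 𝓘(ℝ, E) 𝓘(ℝ, E) e'.symm (e' q1) : E → E)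
      (fderiv ℝ (e' ∘ e.symm) (e q) v)) := by
    rintro q1 rfl q2 rfl
    exact congrArg _ (DFunLike.congr_fun h v)
  refine key _ (e.left_inv hq) _ ?_
  rw [e.left_inv hq, e'.left_inv hy.2]

theorem OneForm.contDiffAt_inChart_of (α : OneForm E P)
    (he : e ∈ IsManifold.maximalAtlas 𝓘(ℝ, E) ∞ P)
    (he' : e' ∈ IsManifold.maximalAtlas 𝓘(ℝ, E) ∞ P) {p : P} (hp : p ∈ e.source)
    (hp' : p ∈ e'.source) (h : ContDiffAt ℝ ∞ (α.inChart e') (e' p)) :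
    ContDiffAt ℝ ∞ (α.inChart e) (e p) := by
  refine ContDiffAt.congr_of_eventuallyEq ?_ (α.inChart_eventuallyEq he he' hp hp')
  have hτ : ContDiffAt ℝ ∞ (e' ∘ e.symm) (e p) :=
    contDiffAt_transition he he' (e.map_source hp) (by rwa [e.left_inv hp])
  have hp'' : (e' ∘ e.symm) (e p) = e' p := by simp [e.left_inv hp]
  refine ContDiffAt.clm_comp ?_ (hτ.fderiv_right (by simp))
  exact ContDiffAt.comp (e p) (by rwa [hp'']) hτ

theorem contMDiffAt_comp_chart_iff {F : Type*} [NormedAddCommGroup F] [NormedSpace ℝ F]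
    (he : e ∈ IsManifold.maximalAtlas 𝓘(ℝ, E) ∞ P) {p : P} (hp : p ∈ e.source) (f : P → F) :
    ContMDiffAt 𝓘(ℝ, E) 𝓘(ℝ, F) ∞ f p ↔ ContDiffAt ℝ ∞ (f ∘ e.symm) (e p) := by
  rw [← contMDiffAt_iff_contDiffAt]
  constructor
  · intro h
    exact ContMDiffAt.comp (e p) (by rwa [e.left_inv hp])
      (contMDiffAt_symm_of_mem_maximalAtlas he (e.map_source hp))
  · intro h
    have h2 := h.comp p (contMDiffAt_of_mem_maximalAtlas he hp)
    refine h2.congr_of_eventuallyEq ?_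
    filter_upwards [e.open_source.mem_nhds hp] with q hq
    simp [e.left_inv hq]

theorem contMDiffAt_comp_chart_iff' {F : Type*} [NormedAddCommGroup F] [NormedSpace ℝ F]
    (he : e ∈ IsManifold.maximalAtlas 𝓘(ℝ, E) ∞ P) {p : P} (hp : p ∈ e.source) (f : E → F) :
    ContMDiffAt 𝓘(ℝ, E) 𝓘(ℝ, F) ∞ (f ∘ e) p ↔ ContDiffAt ℝ ∞ f (e p) := by
  rw [contMDiffAt_comp_chart_iff he hp]
  refine ⟨fun h => h.congr_of_eventuallyEq ?_, fun h => h.congr_of_eventuallyEq ?_⟩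
  all_goals
    filter_upwards [e.open_target.mem_nhds (e.map_source hp)] with y hy
    simp [e.right_inv hy]

variable [IsManifold 𝓘(ℝ, E) ∞ P]

/-- Smoothness as a section is read in the trivialization of the cotangent bundle, whose coordinates
at nearby points are precisely the chart expression. -/
theorem OneForm.smoothAt_iff_chartAt (α : OneForm E P) (p : P) :
    α.SmoothAt p ↔ ContDiffAt ℝ ∞ (α.inChart (chartAt E p)) (chartAt E p p) := by
  have hp : p ∈ (chartAt E p).source := mem_chart_source E p
  have he := IsManifold.chart_mem_maximalAtlas (I := 𝓘(ℝ, E)) (n := ∞) p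
  rw [← contMDiffAt_comp_chart_iff' he hp]
  unfold OneForm.SmoothAt
  erw [contMDiffAt_hom_bundle (E₂ := Bundle.Trivial P ℝ)]
  refine (and_iff_right contMDiffAt_id).trans (Filter.EventuallyEq.contMDiffAt_iff ?_)
  filter_upwards [(chartAt E p).open_source.mem_nhds hp] with q hq
  ext v
  have h1 := TangentBundle.symmL_trivializationAt (I := 𝓘(ℝ, E)) hq
  rw [ContinuousLinearMap.inCoordinates, h1]
  simp [OneForm.inChart]
  have key : ∀ q', q' = q → ∀ w : E, (α q : E → ℝ) w = (α q' : E → ℝ) w := by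
    rintro _ rfl _
    rfl
  exact key _ ((chartAt E p).left_inv hq) _

theorem OneForm.smoothAt_iff (α : OneForm E P)
    (he : e ∈ IsManifold.maximalAtlas 𝓘(ℝ, E) ∞ P) {p : P} (hp : p ∈ e.source) :
    α.SmoothAt p ↔ ContDiffAt ℝ ∞ (α.inChart e) (e p) := by
  rw [α.smoothAt_iff_chartAt p]
  have he' := IsManifold.chart_mem_maximalAtlas (I := 𝓘(ℝ, E)) (n := ∞) p
  exact ⟨α.contDiffAt_inChart_of he he' hp (mem_chart_source E p),
    α.contDiffAt_inChart_of he' he (mem_chart_source E p) hp⟩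

/-- The definition of `Form.d` uses the preferred chart at each point; naturality of `extDeriv`
under the transition map frees it from that choice, so that a Darboux chart can be used instead. -/
theorem Form.d_eq_extDeriv_inChart [FiniteDimensional ℝ E] {k : ℕ} (η : Form E P k)
    (he : e ∈ IsManifold.maximalAtlas 𝓘(ℝ, E) ∞ P) {p : P} (hp : p ∈ e.source)
    (hη : DifferentiableAt ℝ (η.inChart e) (e p)) :
    η.d p = (extDeriv (η.inChart e) (e p)).toAlternatingMap.compLinearMap
      (chartEquiv he hp : TangentSpace 𝓘(ℝ, E) p →L[ℝ] E).toLinearMap := by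
  have hp' : p ∈ (chartAt E p).source := mem_chart_source E p
  have he' := IsManifold.chart_mem_maximalAtlas (I := 𝓘(ℝ, E)) (n := ∞) p
  set φ := chartAt E p
  have hτ : ContDiffAt ℝ ∞ (e ∘ φ.symm) (φ p) :=
    contDiffAt_transition he' he (φ.map_source hp') (by rwa [φ.left_inv hp'])
  have hpp : (e ∘ φ.symm) (φ p) = e p := by simp [φ.left_inv hp']
  have h := (η.inChart_eventuallyEq he' he hp' hp).extDeriv_eq
  rw [extDeriv_pullback (r := ∞) (by rwa [hpp]) hτ (by simpa using two_le_infty)] at h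
  rw [hpp] at h
  rw [Form.d, h]
  ext v
  have hc : ∀ w : TangentSpace 𝓘(ℝ, E) p, fderiv ℝ (e ∘ φ.symm) (φ p)
      (mfderiv 𝓘(ℝ, E) 𝓘(ℝ, E) φ p w) = chartEquiv he hp w := by
    intro w
    have h2 := DFunLike.congr_fun (mfderiv_symm_transition he' he hp' hp rfl)
      (mfderiv 𝓘(ℝ, E) 𝓘(ℝ, E) φ p w)
    have h3 : mfderiv 𝓘(ℝ, E) 𝓘(ℝ, E) φ.symm (φ p) (mfderiv 𝓘(ℝ, E) 𝓘(ℝ, E) φ p w) = w :=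
      (chartEquiv he' hp').symm_apply_apply w
    have h4 : (chartEquiv he hp).symm (fderiv ℝ (e ∘ φ.symm) (φ p)
      (mfderiv 𝓘(ℝ, E) 𝓘(ℝ, E) φ p w)) = w := h2.symm.trans h3
    rw [← h4, ContinuousLinearEquiv.apply_symm_apply, h4]
  change extDeriv (η.inChart e) (e p) (fun i => fderiv ℝ (e ∘ φ.symm) (φ p)
      (mfderiv 𝓘(ℝ, E) 𝓘(ℝ, E) φ p (v i))) = extDeriv (η.inChart e) (e p)
      (fun i => chartEquiv he hp (v i))
  simp_rw [hc]

end Charts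

/-! ### One-forms with constant coefficients in a chart -/

section LocalOneForms

theorem sum_smul_comp {ι V W : Type*} [Fintype ι] [AddCommGroup V] [Module ℝ V] [TopologicalSpace V]
    [AddCommGroup W] [Module ℝ W] [TopologicalSpace W] (r : ι → ℝ) (a : ι → W →L[ℝ] ℝ)
    (L : V →L[ℝ] W) : (∑ i, r i • a i).comp L = ∑ i, r i • (a i).comp L := by
  ext v
  simp

variable {E : Type*} [NormedAddCommGroup E] [NormedSpace ℝ E]
  {P : Type*} [TopologicalSpace P] [ChartedSpace E P]

/-- The one-form with constant coefficients `a` in a chart. -/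
def constForm (e : OpenPartialHomeomorph P E) (a : E →L[ℝ] ℝ) : OneForm E P := fun q =>
  a.comp (mfderiv 𝓘(ℝ, E) 𝓘(ℝ, E) e q : TangentSpace 𝓘(ℝ, E) q →L[ℝ] E)

variable {e : OpenPartialHomeomorph P E}

theorem constForm_apply (he : e ∈ IsManifold.maximalAtlas 𝓘(ℝ, E) ∞ P) {p : P} (hp : p ∈ e.source)
    (a : E →L[ℝ] ℝ) :
    constForm e a p = a.comp (chartEquiv he hp : TangentSpace 𝓘(ℝ, E) p →L[ℝ] E) := rfl

theorem OneForm.inChart_apply (he : e ∈ IsManifold.maximalAtlas 𝓘(ℝ, E) ∞ P) {p : P}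
    (hp : p ∈ e.source) (α : OneForm E P) :
    α.inChart e (e p) = (α p).comp ((chartEquiv he hp).symm : E →L[ℝ] TangentSpace 𝓘(ℝ, E) p) := by
  ext v
  have key : ∀ q, q = p → (α q : E → ℝ) ((mfderiv 𝓘(ℝ, E) 𝓘(ℝ, E) e.symm (e p) : E → E) v)
      = (α p : E → ℝ) ((mfderiv 𝓘(ℝ, E) 𝓘(ℝ, E) e.symm (e p) : E → E) v) := by
    rintro _ rfl
    rfl
  exact key _ (e.left_inv hp)

theorem constForm_inChart (he : e ∈ IsManifold.maximalAtlas 𝓘(ℝ, E) ∞ P) {p : P} (hp : p ∈ e.source)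
    (α : OneForm E P) : constForm e (α.inChart e (e p)) p = α p := by
  rw [constForm_apply he hp, OneForm.inChart_apply he hp]
  ext v
  exact congrArg _ ((chartEquiv he hp).symm_apply_apply v)

theorem inChart_constForm (he : e ∈ IsManifold.maximalAtlas 𝓘(ℝ, E) ∞ P) {y : E}
    (hy : y ∈ e.target) (a : E →L[ℝ] ℝ) : (constForm e a).inChart e y = a := by
  obtain ⟨q, hq, rfl⟩ : ∃ q ∈ e.source, e q = y := ⟨_, e.map_target hy, e.right_inv hy⟩
  rw [OneForm.inChart_apply he hq, constForm_apply he hq]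
  ext v
  exact congrArg _ ((chartEquiv he hq).apply_symm_apply v)

theorem differential_comp_chart (he : e ∈ IsManifold.maximalAtlas 𝓘(ℝ, E) ∞ P) {p : P}
    (hp : p ∈ e.source) {g : E → ℝ} {g' : E →L[ℝ] ℝ} (hg : HasFDerivAt g g' (e p)) {f : P → ℝ}
    (hf : f =ᶠ[𝓝 p] g ∘ e) (w : TangentSpace 𝓘(ℝ, E) p) :
    differential f p w = g' (chartEquiv he hp w) := by
  have h := hg.hasMFDerivAt.comp p
    ((mdifferentiable_of_mem_maximalAtlas he).mdifferentiableAt hp).hasMFDerivAt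
  have h2 := (h.congr_of_eventuallyEq hf).mfderiv
  rw [differential, h2]
  rfl

theorem differential_of_eventuallyEq_const {f : P → ℝ} {c : ℝ} {p : P}
    (h : ∀ᶠ q in 𝓝 p, f q = c) : differential (E := E) f p = 0 := by
  have h1 : f =ᶠ[𝓝 p] fun _ => c := h
  rw [differential, h1.mfderiv_eq, mfderiv_const]
  rfl

variable [IsManifold 𝓘(ℝ, E) ∞ P]

theorem smoothAt_constForm (he : e ∈ IsManifold.maximalAtlas 𝓘(ℝ, E) ∞ P) {p : P}
    (hp : p ∈ e.source) (a : E →L[ℝ] ℝ) : (constForm e a).SmoothAt p := by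
  rw [OneForm.smoothAt_iff _ he hp]
  refine (contDiffAt_const (c := a)).congr_of_eventuallyEq ?_
  filter_upwards [e.open_target.mem_nhds (e.map_source hp)] with y hy
  exact inChart_constForm he hy a

theorem OneForm.SmoothAt.congr {α β : OneForm E P} {p : P} (h : α.SmoothAt p)
    (hαβ : ∀ᶠ q in 𝓝 p, α q = β q) : β.SmoothAt p := by
  unfold OneForm.SmoothAt at h ⊢
  refine h.congr_of_eventuallyEq ?_
  filter_upwards [hαβ] with q hq
  rw [hq]

theorem OneForm.SmoothAt.add {α β : OneForm E P} {p : P} (hα : α.SmoothAt p)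
    (hβ : β.SmoothAt p) : (α + β).SmoothAt p := by
  rw [OneForm.smoothAt_iff_chartAt] at *
  exact (hα.add hβ).congr_of_eventuallyEq (Filter.Eventually.of_forall fun y => rfl)

theorem OneForm.SmoothAt.smul {f : P → ℝ} {α : OneForm E P} {p : P}
    (hf : SmoothFunAt (E := E) f p) (hα : α.SmoothAt p) :
    OneForm.SmoothAt (fun q => f q • α q) p := by
  rw [OneForm.smoothAt_iff_chartAt] at *
  have hf' := (contMDiffAt_comp_chart_iff (IsManifold.chart_mem_maximalAtlas (I := 𝓘(ℝ, E))
    (n := ∞) p) (mem_chart_source E p) f).mp hf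
  exact (hf'.smul hα).congr_of_eventuallyEq (Filter.Eventually.of_forall fun y => rfl)

theorem OneForm.smoothAt_zero (p : P) : (0 : OneForm E P).SmoothAt p := by
  rw [OneForm.smoothAt_iff_chartAt]
  exact (contDiffAt_const (c := (0 : E →L[ℝ] ℝ))).congr_of_eventuallyEq
    (Filter.Eventually.of_forall fun y => rfl)

theorem OneForm.SmoothAt.sum {ι : Type*} {s : Finset ι} {α : ι → OneForm E P} {p : P}
    (h : ∀ i ∈ s, (α i).SmoothAt p) : (∑ i ∈ s, α i).SmoothAt p := by
  classical
  induction s using Finset.induction_on with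
  | empty => exact OneForm.smoothAt_zero p
  | insert i s hi ih =>
    rw [Finset.sum_insert hi]
    exact (h i (Finset.mem_insert_self i s)).add
      (ih fun j hj => h j (Finset.mem_insert_of_mem hj))

end LocalOneForms

/-! ### Locality and Christoffel symbols of a contravariant derivative -/

namespace ContravariantDerivative

variable {E : Type*} [NormedAddCommGroup E] [NormedSpace ℝ E] [FiniteDimensional ℝ E]
  {P : Type*} [TopologicalSpace P] [ChartedSpace E P] [IsManifold 𝓘(ℝ, E) ∞ P]
  {σ : Form E P 2} (D : ContravariantDerivative σ) {e : OpenPartialHomeomorph P E}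

/-- The usual locality argument: multiply by a cutoff `f` that is 1 near `p`, and note that the
Leibniz rule sees only `f p = 1` and `df = 0` there. -/
theorem toFun_congr {α β : OneForm E P} {p : P} (hα : α.SmoothAt p)
    (h : ∀ᶠ q in 𝓝 p, α q = β q) : D.toFun α p = D.toFun β p := by
  classical
  obtain ⟨U, hU, hUo, hpU⟩ := eventually_nhds_iff.mp h
  -- No bump function is needed: `D` accepts arbitrary sections, and its axioms ask for smoothness
  -- only at `p`, where this indicator is locally constant.
  let f : P → ℝ := fun q => if q ∈ U then 1 else 0
  have hf : ∀ᶠ q in 𝓝 p, f q = 1 := by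
    filter_upwards [hUo.mem_nhds hpU] with q hq
    simp [f, hq]
  have hfs : SmoothFunAt (E := E) f p :=
    (contMDiffAt_const (c := (1 : ℝ))).congr_of_eventuallyEq hf
  have hfe : (fun q => f q • α q) = fun q => f q • β q := by
    funext q
    by_cases hq : q ∈ U
    · rw [hU q hq]
    · simp [f, hq]
  have hd := differential_of_eventuallyEq_const (E := E) hf
  ext1 η
  have h1 := D.leibniz f α p hfs hα η
  have h2 := D.leibniz f β p hfs (hα.congr h) η
  rw [hd, hf.self_of_nhds] at h1 h2
  simp only [one_smul, zero_apply, zero_smul, add_zero] at h1 h2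
  rw [← h1, ← h2, hfe]

theorem toFun_add_apply {α β : OneForm E P} {p : P} (hα : α.SmoothAt p) (hβ : β.SmoothAt p)
    (η : TangentSpace 𝓘(ℝ, E) p →L[ℝ] ℝ) :
    D.toFun (α + β) p η = D.toFun α p η + D.toFun β p η :=
  congrArg (fun T => T η) (D.add α β p hα hβ)

theorem toFun_sum_apply {ι : Type*} (s : Finset ι) (α : ι → OneForm E P) {p : P}
    (h : ∀ i ∈ s, (α i).SmoothAt p) (η : TangentSpace 𝓘(ℝ, E) p →L[ℝ] ℝ) :
    D.toFun (∑ i ∈ s, α i) p η = ∑ i ∈ s, D.toFun (α i) p η := by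
  classical
  induction s using Finset.induction_on with
  | empty =>
    -- Additivity applied to `0 + 0` forces the value at the zero form to vanish.
    have := D.toFun_add_apply (OneForm.smoothAt_zero p) (OneForm.smoothAt_zero p) η
    rw [add_zero] at this
    simpa using this
  | insert i s hi ih =>
    have hs : ∀ j ∈ s, (α j).SmoothAt p := fun j hj => h j (Finset.mem_insert_of_mem hj)
    rw [Finset.sum_insert hi, Finset.sum_insert hi,
      D.toFun_add_apply (h i (Finset.mem_insert_self i s)) (OneForm.SmoothAt.sum hs), ih hs]

/-- The action of `D` on one-forms with constant coefficients in a chart: the Christoffel symbols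
of `D` in that chart, at a point. -/
def christoffel (he : e ∈ IsManifold.maximalAtlas 𝓘(ℝ, E) ∞ P) {p : P} (hp : p ∈ e.source)
    (η : TangentSpace 𝓘(ℝ, E) p →L[ℝ] ℝ) :
    (TangentSpace 𝓘(ℝ, E) p →L[ℝ] ℝ) →ₗ[ℝ] (TangentSpace 𝓘(ℝ, E) p →L[ℝ] ℝ) where
  toFun b := D.toFun (constForm e
    (b.comp ((chartEquiv he hp).symm : E →L[ℝ] TangentSpace 𝓘(ℝ, E) p))) p η
  map_add' b c := by
    rw [← D.toFun_add_apply (smoothAt_constForm he hp _) (smoothAt_constForm he hp _) η]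
    rfl
  map_smul' r b := by
    -- Homogeneity is the Leibniz rule for a constant function, whose differential vanishes.
    have h := D.leibniz (fun _ => r) (constForm e
      (b.comp ((chartEquiv he hp).symm : E →L[ℝ] TangentSpace 𝓘(ℝ, E) p))) p contMDiffAt_const
      (smoothAt_constForm he hp _) η
    rw [differential_of_eventuallyEq_const (Filter.Eventually.of_forall fun _ => rfl)] at h
    rw [zero_apply, zero_smul, add_zero] at h
    exact h

theorem christoffel_comp (he : e ∈ IsManifold.maximalAtlas 𝓘(ℝ, E) ∞ P) {p : P}
    (hp : p ∈ e.source) (η : TangentSpace 𝓘(ℝ, E) p →L[ℝ] ℝ) (a : E →L[ℝ] ℝ) :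
    D.christoffel he hp η (a.comp (chartEquiv he hp : TangentSpace 𝓘(ℝ, E) p →L[ℝ] E))
      = D.toFun (constForm e a) p η := by
  change D.toFun (constForm e _) p η = _
  congr 3
  ext v
  exact congrArg a ((chartEquiv he hp).apply_symm_apply v)

/-- `D_η α` in coordinates. -/
theorem toFun_eq (he : e ∈ IsManifold.maximalAtlas 𝓘(ℝ, E) ∞ P) {p : P} (hp : p ∈ e.source)
    (η : TangentSpace 𝓘(ℝ, E) p →L[ℝ] ℝ) {α : OneForm E P} (hα : α.SmoothAt p) :
    D.toFun α p η = (fderiv ℝ (α.inChart e) (e p) (chartEquiv he hp (sharp σ p η))).comp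
        (chartEquiv he hp : TangentSpace 𝓘(ℝ, E) p →L[ℝ] E)
      + D.christoffel he hp η (α p) := by
  -- Near `p`, `α` is a combination of constant-coefficient forms with functions `c i` as
  -- coefficients. The Leibniz rule separates the derivatives of the `c i` from the Christoffel
  -- part.
  let b := Module.finBasis ℝ (E →L[ℝ] ℝ)
  let κ : ∀ i, (E →L[ℝ] ℝ) →L[ℝ] ℝ := fun i => LinearMap.toContinuousLinearMap (b.coord i)
  have hκ : ∀ a : E →L[ℝ] ℝ, ∑ i, κ i a • b i = a := fun a => b.sum_repr a
  have hαc := (OneForm.smoothAt_iff α he hp).mp hα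
  have hαd : DifferentiableAt ℝ (α.inChart e) (e p) := hαc.differentiableAt (by simp)
  let c : ∀ _, P → ℝ := fun i q => κ i (α.inChart e (e q))
  have hc : ∀ i, SmoothFunAt (E := E) (c i) p := fun i =>
    (contMDiffAt_comp_chart_iff' he hp _).mpr ((κ i).contDiff.contDiffAt.comp _ hαc)
  have hdc : ∀ i w, differential (c i) p w
      = κ i (fderiv ℝ (α.inChart e) (e p) (chartEquiv he hp w)) := fun i w =>
    differential_comp_chart he hp ((κ i).hasFDerivAt.comp _ hαd.hasFDerivAt)
      (Filter.EventuallyEq.rfl) w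
  let β : ∀ _, OneForm E P := fun i q => c i q • constForm e (b i) q
  have hβ : ∀ i ∈ Finset.univ, (β i).SmoothAt p := fun i _ =>
    OneForm.SmoothAt.smul (hc i) (smoothAt_constForm he hp _)
  have hsum : ∀ᶠ q in 𝓝 p, α q = (∑ i, β i) q := by
    filter_upwards [e.open_source.mem_nhds hp] with q hq
    rw [← constForm_inChart he hq α, Finset.sum_apply]
    conv_lhs => rw [← hκ (α.inChart e (e q))]
    exact sum_smul_comp _ _ _
  rw [D.toFun_congr hα hsum, D.toFun_sum_apply _ _ hβ]
  have hterm : ∀ i, D.toFun (β i) p η = c i p • D.toFun (constForm e (b i)) p η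
      + (differential (c i) p (sharp σ p η)) • constForm e (b i) p := fun i =>
    D.leibniz (c i) _ p (hc i) (smoothAt_constForm he hp _) η
  simp only [hterm, Finset.sum_add_distrib, hdc]
  rw [add_comm]
  congr 1
  · conv_rhs => rw [← hκ (fderiv ℝ (α.inChart e) (e p) (chartEquiv he hp (sharp σ p η)))]
    exact (sum_smul_comp _ _ _).symm
  · rw [← constForm_inChart he hp α]
    conv_rhs => rw [← hκ (α.inChart e (e p))]
    have : constForm e (∑ i, κ i (α.inChart e (e p)) • b i) p
        = ∑ i, κ i (α.inChart e (e p)) • (b i).comp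
          (chartEquiv he hp : TangentSpace 𝓘(ℝ, E) p →L[ℝ] E) :=
      sum_smul_comp _ _ _
    rw [this, map_sum]
    simp only [map_smul, christoffel_comp]
    rfl

end ContravariantDerivative

/-! ### Differentiating multivector fields in a chart -/

section MultivectorFields

universe u

/-- A curve of vectors in a finite dimensional space, all of whose coordinates are differentiable,
has a derivative, to which linear maps to normed spaces may be applied. -/
theorem exists_hasFDerivAt_linear {E : Type u} [NormedAddCommGroup E] [NormedSpace ℝ E]
    [FiniteDimensional ℝ E] {M ι : Type*} [AddCommGroup M] [Module ℝ M] [Fintype ι]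
    (B : Module.Basis ι ℝ M) {g : E → M} {x : E}
    (hg : ∀ i, DifferentiableAt ℝ (fun y => B.repr (g y) i) x) :
    ∃ g' : E →ₗ[ℝ] M, ∀ {F : Type u} [NormedAddCommGroup F] [NormedSpace ℝ F] (T : M →ₗ[ℝ] F),
      HasFDerivAt (fun y => T (g y)) (LinearMap.toContinuousLinearMap (T ∘ₗ g')) x := by
  -- No norm on `M` is assumed, so the derivative is assembled from coordinate derivatives as a
  -- plain linear map; the same `g'` serves every `T`.
  refine ⟨∑ i, (fderiv ℝ (fun y => B.repr (g y) i) x).toLinearMap.smulRight (B i), ?_⟩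
  intro F _ _ T
  have h1 : (fun y => T (g y)) = fun y => ∑ i, B.repr (g y) i • T (B i) := by
    funext y
    conv_lhs => rw [← B.sum_repr (g y), map_sum]
    simp
  have h2 : HasFDerivAt (fun y => ∑ i, B.repr (g y) i • T (B i))
      (∑ i, (fderiv ℝ (fun y => B.repr (g y) i) x).smulRight (T (B i))) x :=
    HasFDerivAt.fun_sum fun i _ => (hg i).hasFDerivAt.smul_const (T (B i))
  rw [h1]
  convert! h2 using 1
  ext v
  simp

variable {E : Type u} [NormedAddCommGroup E] [NormedSpace ℝ E]
  {P : Type*} [TopologicalSpace P] [ChartedSpace E P] {e : OpenPartialHomeomorph P E}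

/-- The expression of a multivector field in a chart. -/
def MultivectorField.inChart {k : ℕ} (A : MultivectorField E P k) (e : OpenPartialHomeomorph P E)
    (y : E) : ⋀[ℝ]^k E :=
  exteriorPower.map k (mfderiv 𝓘(ℝ, E) 𝓘(ℝ, E) e (e.symm y) :
    TangentSpace 𝓘(ℝ, E) (e.symm y) →L[ℝ] E).toLinearMap (A (e.symm y))

theorem MultivectorField.inChart_apply (he : e ∈ IsManifold.maximalAtlas 𝓘(ℝ, E) ∞ P) {p : P}
    (hp : p ∈ e.source) {k : ℕ} (A : MultivectorField E P k) :
    A.inChart e (e p) = exteriorPower.map k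
      (chartEquiv he hp : TangentSpace 𝓘(ℝ, E) p →L[ℝ] E).toLinearMap (A p) := by
  have key : ∀ q, q = p → exteriorPower.map k (mfderiv 𝓘(ℝ, E) 𝓘(ℝ, E) e q :
      TangentSpace 𝓘(ℝ, E) q →L[ℝ] E).toLinearMap (A q) = exteriorPower.map k
      (mfderiv 𝓘(ℝ, E) 𝓘(ℝ, E) e p : TangentSpace 𝓘(ℝ, E) p →L[ℝ] E).toLinearMap (A p) := by
    rintro _ rfl
    rfl
  exact key _ (e.left_inv hp)

/-- The map on multivectors induced by the differential of a chart. -/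
def chartMultivectorEquiv (he : e ∈ IsManifold.maximalAtlas 𝓘(ℝ, E) ∞ P) {p : P}
    (hp : p ∈ e.source) (k : ℕ) : (⋀[ℝ]^k (TangentSpace 𝓘(ℝ, E) p)) ≃ₗ[ℝ] ⋀[ℝ]^k E :=
  LinearEquiv.ofLinearMap
    (exteriorPower.map k (chartEquiv he hp : TangentSpace 𝓘(ℝ, E) p →L[ℝ] E).toLinearMap)
    (exteriorPower.map k ((chartEquiv he hp).symm : E →L[ℝ] TangentSpace 𝓘(ℝ, E) p).toLinearMap)
    (by
      rw [← exteriorPower.map_comp, ← exteriorPower.map_id]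
      congr 1
      ext v
      exact (chartEquiv he hp).apply_symm_apply v)
    (by
      rw [← exteriorPower.map_comp, ← exteriorPower.map_id]
      congr 1
      ext v
      exact (chartEquiv he hp).symm_apply_apply v)

theorem pairing_inChart (he : e ∈ IsManifold.maximalAtlas 𝓘(ℝ, E) ∞ P) {p : P}
    (hp : p ∈ e.source) {k : ℕ} (A : MultivectorField E P k) (α : Fin k → OneForm E P) :
    pairing (fun i => (α i p).toLinearMap) (A p)
      = pairing (fun i => ((α i).inChart e (e p)).toLinearMap) (A.inChart e (e p)) := by
  rw [MultivectorField.inChart_apply he hp, pairing_map]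
  congr 1
  ext i v
  rw [OneForm.inChart_apply he hp]
  exact congrArg (α i p) ((chartEquiv he hp).symm_apply_apply v).symm

theorem pairing_chartMultivectorEquiv_symm (he : e ∈ IsManifold.maximalAtlas 𝓘(ℝ, E) ∞ P) {p : P}
    (hp : p ∈ e.source) {k : ℕ} (α : Fin k → E →L[ℝ] ℝ) (X : ⋀[ℝ]^k E) :
    pairing (fun i => ((α i).comp
      (chartEquiv he hp : TangentSpace 𝓘(ℝ, E) p →L[ℝ] E)).toLinearMap)
      ((chartMultivectorEquiv he hp k).symm X) = pairing (fun i => (α i).toLinearMap) X := by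
  conv_rhs => rw [← (chartMultivectorEquiv he hp k).apply_symm_apply X]
  exact (pairing_map _ _ _).symm

variable [FiniteDimensional ℝ E]

/-- The pairing with continuous covectors, as a continuous alternating form. -/
def pairingCont (k : ℕ) : ⋀[ℝ]^k E →ₗ[ℝ] (E →L[ℝ] ℝ) [⋀^Fin k]→L[ℝ] ℝ where
  toFun X := toContinuousForm ((pairingAlt X).compLinearMap (ContinuousLinearMap.coeLM ℝ))
  map_add' X Y := by
    ext α
    exact map_add (pairingLin fun i => (α i).toLinearMap) X Y
  map_smul' c X := by
    ext α
    exact map_smul (pairingLin fun i => (α i).toLinearMap) c X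

theorem pairingCont_apply {k : ℕ} (X : ⋀[ℝ]^k E) (α : Fin k → E →L[ℝ] ℝ) :
    pairingCont k X α = pairing (fun i => (α i).toLinearMap) X := rfl

variable [IsManifold 𝓘(ℝ, E) ∞ P]

/-- Smoothness is given only through pairings. Pairing with constant forms taken from a dual basis
recovers each coordinate of the chart expression. -/
theorem MultivectorField.SmoothAt.exists_hasFDerivAt {k : ℕ} {A : MultivectorField E P k} {p : P}
    (hA : A.SmoothAt p) (he : e ∈ IsManifold.maximalAtlas 𝓘(ℝ, E) ∞ P) (hp : p ∈ e.source) :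
    ∃ A' : E →ₗ[ℝ] ⋀[ℝ]^k E, ∀ {F : Type u} [NormedAddCommGroup F] [NormedSpace ℝ F]
      (T : ⋀[ℝ]^k E →ₗ[ℝ] F), HasFDerivAt (fun y => T (A.inChart e y))
        (LinearMap.toContinuousLinearMap (T ∘ₗ A')) (e p) := by
  refine exists_hasFDerivAt_linear ((Module.finBasis ℝ E).exteriorPower k) fun s => ?_
  let b := Module.finBasis ℝ E
  let α : Fin k → OneForm E P := fun i => constForm e
    (LinearMap.toContinuousLinearMap (b.coord (Set.powersetCard.ofFinEmbEquiv.symm s i)))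
  have h := hA α fun i => smoothAt_constForm he hp _
  have h2 := (contMDiffAt_comp_chart_iff he hp _).mp h
  refine (h2.differentiableAt (by simp)).congr_of_eventuallyEq ?_
  filter_upwards [e.open_target.mem_nhds (e.map_source hp)] with y hy
  obtain ⟨q, hq, rfl⟩ : ∃ q ∈ e.source, e q = y := ⟨_, e.map_target hy, e.right_inv hy⟩
  rw [Function.comp_apply, e.left_inv hq, pairing_inChart he hq,
    exteriorPower.basis_repr_apply]
  simp only [α, inChart_constForm he hy]
  rfl

/-- In a chart, the derivative of a multivector field and the derivatives of one-forms together
give the derivative of the pairing. -/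
theorem differential_pairing {k : ℕ} {A : MultivectorField E P k}
    {p : P} {A' : E →ₗ[ℝ] ⋀[ℝ]^k E} (he : e ∈ IsManifold.maximalAtlas 𝓘(ℝ, E) ∞ P)
    (hp : p ∈ e.source)
    (hA' : HasFDerivAt (fun y => pairingCont k (A.inChart e y))
        (LinearMap.toContinuousLinearMap (pairingCont k ∘ₗ A')) (e p))
    (α : Fin k → OneForm E P) (hα : ∀ i, (α i).SmoothAt p) (w : TangentSpace 𝓘(ℝ, E) p) :
    differential (E := E) (fun q => pairing (fun i => (α i q).toLinearMap) (A q)) p w =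
      pairing (fun i => (α i p).toLinearMap)
        ((chartMultivectorEquiv he hp k).symm (A' (chartEquiv he hp w)))
      + ∑ i, pairing (Function.update (fun j => (α j p).toLinearMap) i
          ((fderiv ℝ ((α i).inChart e) (e p) (chartEquiv he hp w)).comp
            (chartEquiv he hp : TangentSpace 𝓘(ℝ, E) p →L[ℝ] E)).toLinearMap) (A p) := by
  have hαd : ∀ i, DifferentiableAt ℝ ((α i).inChart e) (e p) :=
    fun i => ((OneForm.smoothAt_iff (α i) he hp).mp (hα i)).differentiableAt (by simp)
  have hev : (fun q => pairing (fun i => (α i q).toLinearMap) (A q)) =ᶠ[𝓝 p]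
      (fun y => pairingCont k (A.inChart e y) (fun i => (α i).inChart e y)) ∘ e := by
    filter_upwards [e.open_source.mem_nhds hp] with q hq
    exact pairing_inChart he hq A α
  have hd := (hA'.differentiableAt.continuousAlternatingMap_apply hαd).hasFDerivAt
  rw [differential_comp_chart he hp hd hev,
    fderiv_continuousAlternatingMap_apply_apply hA'.differentiableAt hαd, hA'.fderiv]
  have hAp : A p = (chartMultivectorEquiv he hp k).symm (A.inChart e (e p)) := by
    rw [MultivectorField.inChart_apply he hp]
    exact ((chartMultivectorEquiv he hp k).symm_apply_apply (A p)).symm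
  have hαp : (fun i => (α i p).toLinearMap) = fun i => (((α i).inChart e (e p)).comp
      (chartEquiv he hp : TangentSpace 𝓘(ℝ, E) p →L[ℝ] E)).toLinearMap :=
    funext fun i => congrArg _ (constForm_inChart he hp (α i)).symm
  refine congrArg₂ (· + ·) ?_ (Finset.sum_congr rfl fun i _ => ?_)
  · rw [hαp, pairing_chartMultivectorEquiv_symm]
    rfl
  · have hup : Function.update (fun j => (α j p).toLinearMap) i
          ((fderiv ℝ ((α i).inChart e) (e p) (chartEquiv he hp w)).comp
            (chartEquiv he hp : TangentSpace 𝓘(ℝ, E) p →L[ℝ] E)).toLinearMap = fun j =>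
        ((Function.update (fun j => (α j).inChart e (e p)) i
          (fderiv ℝ ((α i).inChart e) (e p) (chartEquiv he hp w)) j).comp
            (chartEquiv he hp : TangentSpace 𝓘(ℝ, E) p →L[ℝ] E)).toLinearMap := by
      funext j
      by_cases h : j = i
      · subst h
        simp only [Function.update_self]
      · simp only [Function.update_of_ne h]
        exact congrFun hαp j
    rw [hAp, hup, pairing_chartMultivectorEquiv_symm, pairingCont_apply]

end MultivectorFields

/-! ### Cancellation for symmetric families of symplectic endomorphisms -/

section SymplecticDerivations

variable {V W : Type*} [AddCommGroup V] [Module ℝ V] [AddCommGroup W] [Module ℝ W]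

theorem map_contractCovector [FiniteDimensional ℝ W] {k : ℕ} (f : V →ₗ[ℝ] W)
    (ε : Module.Dual ℝ W) (A : ⋀[ℝ]^(k + 1) V) :
    exteriorPower.map k f (contractCovector (ε ∘ₗ f) A)
      = contractCovector ε (exteriorPower.map (k + 1) f A) := by
  refine pairing_ext fun α => ?_
  rw [pairing_map, pairing_contractCovector, pairing_contractCovector, pairing_map]
  congr 1
  ext i : 1
  refine Fin.lastCases ?_ (fun i => ?_) i <;> simp

theorem covectorWedge_compLinearMap {ι : Type*} [Fintype ι] [DecidableEq ι]
    (α : ι → Module.Dual ℝ W) (f : V →ₗ[ℝ] W) :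
    (covectorWedge α).compLinearMap f = covectorWedge fun i => α i ∘ₗ f := by
  ext v
  simp [covectorWedge_apply]

theorem wedge_ofSubsingleton (a b : Module.Dual ℝ V) :
    wedge (AlternatingMap.ofSubsingleton ℝ V ℝ (0 : Fin 1) a)
      (AlternatingMap.ofSubsingleton ℝ V ℝ (0 : Fin 1) b) = covectorWedge ![a, b] := by
  have h : ∀ c : Module.Dual ℝ V, AlternatingMap.ofSubsingleton ℝ V ℝ (0 : Fin 1) c
      = covectorWedge ![c] := by
    intro c
    ext v
    simp [covectorWedge_apply]
  rw [h, h, wedge_covectorWedge]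
  congr 1
  ext i : 1
  fin_cases i <;> rfl

/-- The bilinear form obtained from an alternating map by fixing all but two arguments. -/
def twoSlots {k : ℕ} (M : V [⋀^Fin k]→ₗ[ℝ] ℝ) (v : Fin k → V) {i j : Fin k} (hij : i ≠ j) :
    V →ₗ[ℝ] V →ₗ[ℝ] ℝ :=
  LinearMap.mk₂ ℝ (fun a b => M (Function.update (Function.update v i a) j b))
    (fun a a' b => by simp only [Function.update_comm hij, M.map_update_add])
    (fun c a b => by simp only [Function.update_comm hij, M.map_update_smul])
    (fun a b b' => M.map_update_add _ _ _ _)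
    (fun c a b => M.map_update_smul _ _ _ _)

theorem twoSlots_skew {k : ℕ} (M : V [⋀^Fin k]→ₗ[ℝ] ℝ) (v : Fin k → V) {i j : Fin k}
    (hij : i ≠ j) (a b : V) : twoSlots M v hij a b = -twoSlots M v hij b a := by
  change M _ = - M _
  rw [← M.map_swap _ hij]
  congr 1
  ext l
  by_cases hi : l = i
  · subst hi
    simp [hij]
  · by_cases hj : l = j
    · subst hj
      simp [hij]
    · simp [Equiv.swap_apply_of_ne_of_ne hi hj, hi, hj]

/-- The terms with Christoffel symbols cancel: `G` is symmetric and takes values in the symplectic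
Lie algebra. -/
theorem sum_derivationAlt_eq_zero {m k : ℕ} (M : V [⋀^Fin (k + 1)]→ₗ[ℝ] ℝ) (G : V → V →ₗ[ℝ] V)
    (hG : ∀ a b, G a b = G b a) (x y : Fin m → V) (S Q R : V → Fin m → Fin m → ℝ)
    (hS : ∀ a i j, S a i j = S a j i) (hR : ∀ a i j, R a i j = R a j i)
    (hy : ∀ a i, G a (y i) = ∑ j, (S a i j • x j - Q a i j • y j))
    (hx : ∀ a i, G a (x i) = ∑ j, (Q a j i • x j - R a i j • y j)) (τ : Fin k → V) :
    ∑ i, (derivationAlt M (G (y i)) (Fin.snoc τ (x i) : Fin (k + 1) → V)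
      - derivationAlt M (G (x i)) (Fin.snoc τ (y i) : Fin (k + 1) → V)) = 0 := by
  have hne : ∀ l : Fin k, l.castSucc ≠ Fin.last k := fun l => (Fin.castSucc_lt_last l).ne
  have hterm : ∀ a b : V, derivationAlt M (G a) (Fin.snoc τ b : Fin (k + 1) → V)
      = ∑ l, twoSlots M (Fin.snoc τ 0) (hne l) (G (τ l) a) b
        + M (Fin.snoc τ (G a b) : Fin (k + 1) → V) := by
    intro a b
    rw [derivationAlt_apply, Fin.sum_univ_castSucc]
    congr 1
    · refine Finset.sum_congr rfl fun l _ => ?_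
      change M _ = M _
      congr 1
      rw [Fin.snoc_castSucc (α := fun _ => V), hG a, Function.update_comm (hne l),
        Fin.update_snoc_last]
    · rw [Fin.snoc_last (α := fun _ => V), Fin.update_snoc_last]
  simp only [hterm]
  -- In the last slot both terms insert the same covector, again by symmetry of `G`.
  have hcancel : ∀ i, G (y i) (x i) = G (x i) (y i) := fun i => hG _ _
  simp only [hcancel, add_sub_add_right_eq_sub, ← Finset.sum_sub_distrib]
  rw [Finset.sum_comm]
  refine Finset.sum_eq_zero fun l _ => ?_
  exact sum_skew_symplectic_eq_zero x y (G (τ l)) _ (twoSlots_skew M _ (hne l)) (S (τ l)) (Q (τ l))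
    (R (τ l)) (hS _) (hR _) (hy _) (hx _)

end SymplecticDerivations

/-! ### The derivative of a multivector field in terms of Christoffel symbols -/

namespace ContravariantDerivative

universe u

variable {E : Type u} [NormedAddCommGroup E] [NormedSpace ℝ E] [FiniteDimensional ℝ E]
  {P : Type*} [TopologicalSpace P] [ChartedSpace E P] [IsManifold 𝓘(ℝ, E) ∞ P]
  {σ : Form E P 2} (D : ContravariantDerivative σ) {e : OpenPartialHomeomorph P E}

/-- The Christoffel symbols as endomorphisms of the algebraic dual. -/
def christoffelDual (he : e ∈ IsManifold.maximalAtlas 𝓘(ℝ, E) ∞ P) {p : P} (hp : p ∈ e.source)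
    (η : TangentSpace 𝓘(ℝ, E) p →L[ℝ] ℝ) :
    Module.Dual ℝ (TangentSpace 𝓘(ℝ, E) p) →ₗ[ℝ] Module.Dual ℝ (TangentSpace 𝓘(ℝ, E) p) :=
  (LinearMap.toContinuousLinearMap.symm.toLinearMap ∘ₗ D.christoffel he hp η) ∘ₗ
    LinearMap.toContinuousLinearMap.toLinearMap

theorem christoffelDual_coe (he : e ∈ IsManifold.maximalAtlas 𝓘(ℝ, E) ∞ P) {p : P}
    (hp : p ∈ e.source) (η β : TangentSpace 𝓘(ℝ, E) p →L[ℝ] ℝ) :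
    D.christoffelDual he hp η β.toLinearMap = (D.christoffel he hp η β).toLinearMap := rfl

/-- The product rule for the pairing produces chart derivatives of the `α i`; the same derivatives
occur in `D_η (α i)` by `toFun_eq` and cancel, leaving only the Christoffel derivation. -/
theorem isDerivAt_of_pairing_eq {k : ℕ} {A : MultivectorField E P k}
    {p : P} {A' : E →ₗ[ℝ] ⋀[ℝ]^k E} (he : e ∈ IsManifold.maximalAtlas 𝓘(ℝ, E) ∞ P)
    (hp : p ∈ e.source)
    (hA' : HasFDerivAt (fun y => pairingCont k (A.inChart e y))
        (LinearMap.toContinuousLinearMap (pairingCont k ∘ₗ A')) (e p)) (η : OneForm E P)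
    {B : ⋀[ℝ]^k (TangentSpace 𝓘(ℝ, E) p)}
    (hB : ∀ a, pairing a B = pairing a ((chartMultivectorEquiv he hp k).symm
      (A' (chartEquiv he hp (sharp σ p (η p)))))
        - derivationAlt (pairingAlt (A p)) (D.christoffelDual he hp (η p)) a) :
    D.IsDerivAt η A p B := by
  intro α hα
  rw [hB, differential_pairing he hp hA' α hα, derivationAlt_apply, add_sub_assoc,
    sub_eq_add_neg, ← Finset.sum_sub_distrib, ← Finset.sum_neg_distrib]
  congr 1
  refine Finset.sum_congr rfl fun i _ => ?_
  have hup : (fun j => (Function.update α i (D.onOneForm η (α i)) j p).toLinearMap)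
      = Function.update (fun j => (α j p).toLinearMap) i
        (((fderiv ℝ ((α i).inChart e) (e p) (chartEquiv he hp (sharp σ p (η p)))).comp
            (chartEquiv he hp : TangentSpace 𝓘(ℝ, E) p →L[ℝ] E)).toLinearMap
          + D.christoffelDual he hp (η p) (α i p).toLinearMap) := by
    funext j
    by_cases h : j = i
    · subst h
      rw [Function.update_self, Function.update_self, christoffelDual_coe]
      exact congrArg _ (D.toFun_eq he hp (η p) (hα j))
    · rw [Function.update_of_ne h, Function.update_of_ne h]
  rw [hup, ← pairingAlt_apply, ← pairingAlt_apply, AlternatingMap.map_update_add]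
  ring

/-- The value is chosen by `Classical.epsilon`, so the formula requires that some multivector
satisfies the defining condition and that the condition determines all its pairings. -/
theorem pairing_onMultivector {k : ℕ} {A : MultivectorField E P k}
    {p : P} {A' : E →ₗ[ℝ] ⋀[ℝ]^k E} (he : e ∈ IsManifold.maximalAtlas 𝓘(ℝ, E) ∞ P)
    (hp : p ∈ e.source)
    (hA' : HasFDerivAt (fun y => pairingCont k (A.inChart e y))
        (LinearMap.toContinuousLinearMap (pairingCont k ∘ₗ A')) (e p)) (η : OneForm E P)
    (a : Fin k → Module.Dual ℝ (TangentSpace 𝓘(ℝ, E) p)) :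
    pairing a (D.onMultivector η A p) = pairing a ((chartMultivectorEquiv he hp k).symm
      (A' (chartEquiv he hp (sharp σ p (η p)))))
        - derivationAlt (pairingAlt (A p)) (D.christoffelDual he hp (η p)) a := by
  obtain ⟨B, hB⟩ := exists_pairing_eq (pairingAlt ((chartMultivectorEquiv he hp k).symm
      (A' (chartEquiv he hp (sharp σ p (η p)))))
        - derivationAlt (pairingAlt (A p)) (D.christoffelDual he hp (η p)))
  have h1 : D.IsDerivAt η A p B := D.isDerivAt_of_pairing_eq he hp hA' η hB
  have h2 : D.IsDerivAt η A p (D.onMultivector η A p) :=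
    Classical.epsilon_spec (p := D.IsDerivAt η A p) ⟨B, h1⟩
  -- Uniqueness: every family of covectors at `p` is the value of smooth, constant-coefficient
  -- one-forms.
  let α : Fin k → OneForm E P := fun i => constForm e ((LinearMap.toContinuousLinearMap (a i)).comp
    ((chartEquiv he hp).symm : E →L[ℝ] TangentSpace 𝓘(ℝ, E) p))
  have hα : ∀ i, (α i).SmoothAt p := fun i => smoothAt_constForm he hp _
  have hαp : (fun i => (α i p).toLinearMap) = a := by
    ext i v
    exact congrArg (a i) ((chartEquiv he hp).symm_apply_apply v)
  have h := (h2 α hα).trans (h1 α hα).symm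
  rw [hαp] at h
  exact h.trans (hB a)

end ContravariantDerivative

/-! ### The curl operator of a constant volume form is a divergence -/

section Curl

universe u

variable {E : Type u} [NormedAddCommGroup E] [NormedSpace ℝ E] [FiniteDimensional ℝ E]
  {P : Type*} [TopologicalSpace P] [ChartedSpace E P] {e : OpenPartialHomeomorph P E}

/-- Contraction with a form on a normed space, with values in continuous forms. -/
def interiorProductCont {N a b : ℕ} (η : E [⋀^Fin N]→ₗ[ℝ] ℝ) :
    ⋀[ℝ]^a E →ₗ[ℝ] E [⋀^Fin b]→L[ℝ] ℝ where
  toFun X := toContinuousForm (interiorProduct η X)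
  map_add' X Y := by
    ext v
    exact DFunLike.congr_fun (interiorProduct_add η X Y) v
  map_smul' c X := by
    ext v
    exact DFunLike.congr_fun (interiorProduct_smul η c X) v

theorem interiorProductCont_apply {N a b : ℕ} (η : E [⋀^Fin N]→ₗ[ℝ] ℝ) (X : ⋀[ℝ]^a E)
    (v : Fin b → E) : (interiorProductCont η X : E [⋀^Fin b]→L[ℝ] ℝ) v = interiorProduct η X v :=
  rfl

theorem Form.inChart_apply (he : e ∈ IsManifold.maximalAtlas 𝓘(ℝ, E) ∞ P) {p : P}
    (hp : p ∈ e.source) {k : ℕ} (η : Form E P k) (v : Fin k → E) :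
    η.inChart e (e p) v = η p fun i => (chartEquiv he hp).symm (v i) := by
  have key : ∀ q, q = p →
      η q (fun i => (mfderiv 𝓘(ℝ, E) 𝓘(ℝ, E) e.symm (e p) : E → E) (v i)) =
      η p (fun i => (mfderiv 𝓘(ℝ, E) 𝓘(ℝ, E) e.symm (e p) : E → E) (v i)) := by
    rintro _ rfl
    rfl
  exact key _ (e.left_inv hp)

theorem inChart_interiorProduct (he : e ∈ IsManifold.maximalAtlas 𝓘(ℝ, E) ∞ P) {N a b : ℕ}
    {μ : Form E P N} {μ₀ : E [⋀^Fin N]→ₗ[ℝ] ℝ}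
    (hμ : ∀ q (hq : q ∈ e.source), μ q = μ₀.compLinearMap
      (chartEquiv he hq : TangentSpace 𝓘(ℝ, E) q →L[ℝ] E).toLinearMap)
    (A : MultivectorField E P a) {y : E} (hy : y ∈ e.target) :
    Form.inChart (fun q => (interiorProduct (μ q) (A q) :
      (TangentSpace 𝓘(ℝ, E) q) [⋀^Fin b]→ₗ[ℝ] ℝ)) e y = interiorProductCont μ₀ (A.inChart e y) := by
  obtain ⟨q, hq, rfl⟩ : ∃ q ∈ e.source, e q = y := ⟨_, e.map_target hy, e.right_inv hy⟩
  ext v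
  rw [Form.inChart_apply he hq, hμ q hq, interiorProduct_compLinearMap,
    interiorProductCont_apply, MultivectorField.inChart_apply he hq,
    AlternatingMap.compLinearMap_apply]
  congr 1
  ext i
  exact (chartEquiv he hq).apply_symm_apply (v i)

variable [IsManifold 𝓘(ℝ, E) ∞ P]

/-- The curl operator of a volume form with constant coefficients, in coordinates. -/
theorem curl_eq {N k : ℕ} (hk : k + 1 ≤ N) (v : Module.Basis (Fin N) ℝ E)
    (he : e ∈ IsManifold.maximalAtlas 𝓘(ℝ, E) ∞ P) {μ : Form E P N} {μ₀ : E [⋀^Fin N]→ₗ[ℝ] ℝ}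
    (hμ₀ : μ₀ ≠ 0)
    (hμ : ∀ q (hq : q ∈ e.source), μ q = μ₀.compLinearMap
      (chartEquiv he hq : TangentSpace 𝓘(ℝ, E) q →L[ℝ] E).toLinearMap)
    {A : MultivectorField E P (k + 1)} {p : P} (hp : p ∈ e.source) {A' : E →ₗ[ℝ] ⋀[ℝ]^(k + 1) E}
    (hA' : ∀ {F : Type u} [NormedAddCommGroup F] [NormedSpace ℝ F]
      (T : ⋀[ℝ]^(k + 1) E →ₗ[ℝ] F), HasFDerivAt (fun y => T (A.inChart e y))
        (LinearMap.toContinuousLinearMap (T ∘ₗ A')) (e p)) :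
    curl μ A p = (chartMultivectorEquiv he hp k).symm
      (∑ a, contractCovector (v.coord a) (A' (v a))) := by
  set C : ⋀[ℝ]^k E := ∑ a, contractCovector (v.coord a) (A' (v a)) with hC
  have hfin : Module.finrank ℝ E = N := by
    rw [Module.finrank_eq_card_basis v, Fintype.card_fin]
  set μA : Form E P (N - (k + 1)) := fun q => interiorProduct (μ q) (A q) with hμA
  have hev : μA.inChart e =ᶠ[𝓝 (e p)] fun y => interiorProductCont μ₀ (A.inChart e y) := by
    filter_upwards [e.open_target.mem_nhds (e.map_source hp)] with y hy
    exact inChart_interiorProduct he hμ A hy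
  have hd := (hA' (interiorProductCont μ₀ (b := N - (k + 1)))).congr_of_eventuallyEq hev
  -- The exterior derivative alternates the contractions of `A'` in the directions `w i`. Expanding
  -- each `w i` in the basis `v` gives the sum of `v.coord a ∧ i(A' (v a))μ₀`, and the top-degree
  -- identity pulls each covector back onto the multivector.
  have hext : extDeriv (μA.inChart e) (e p)
      = (interiorProductCont μ₀ C : E [⋀^Fin (N - (k + 1) + 1)]→L[ℝ] ℝ) := by
    ext w
    rw [extDeriv, hd.fderiv, ContinuousAlternatingMap.alternatizeUncurryFin_apply,
      interiorProductCont_apply]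
    have hCw : interiorProduct μ₀ C w
        = ∑ a, interiorProduct μ₀ (contractCovector (v.coord a) (A' (v a))) w := by
      let L : ⋀[ℝ]^k E →ₗ[ℝ] E [⋀^Fin (N - (k + 1) + 1)]→L[ℝ] ℝ := interiorProductCont μ₀
      change L C w = ∑ a, L (contractCovector (v.coord a) (A' (v a))) w
      rw [hC, map_sum, ContinuousAlternatingMap.sum_apply]
    rw [hCw]
    have hlt : Module.finrank ℝ E < k + 1 + (N - (k + 1) + 1) := by omega
    simp only [interiorProduct_contractCovector hlt]
    rw [Finset.sum_comm]
    refine Finset.sum_congr rfl fun i _ => ?_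
    let L : E →ₗ[ℝ] E [⋀^Fin (N - (k + 1))]→L[ℝ] ℝ := interiorProductCont μ₀ ∘ₗ A'
    change (-1 : ℤ) ^ (i : ℕ) • L (w i) (i.removeNth w)
      = ∑ a, (-1) ^ (i : ℕ) * v.repr (w i) a * L (v a) (i.removeNth w)
    conv_lhs => rw [← v.sum_repr (w i), map_sum, ContinuousAlternatingMap.sum_apply]
    rw [Finset.smul_sum]
    refine Finset.sum_congr rfl fun a _ => ?_
    rw [map_smul, ContinuousAlternatingMap.smul_apply, smul_eq_mul, zsmul_eq_mul, mul_assoc]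
    push_cast
    rfl
  have hdp : μA.d p = interiorProduct (μ p) ((chartMultivectorEquiv he hp k).symm C) := by
    rw [μA.d_eq_extDeriv_inChart he hp hd.differentiableAt, hext, hμ p hp,
      interiorProduct_compLinearMap]
    congr 1
    exact congrArg (interiorProduct μ₀) ((chartMultivectorEquiv he hp k).apply_symm_apply C).symm
  change interiorProductInv (μ p) (μA.d p) = _
  rw [hdp]
  -- The bound `hk` enters here: with truncated subtraction, the degrees `k` and `N - (k + 1) + 1`
  -- must add up to `N`.
  refine interiorProductInv_interiorProduct (v.map (chartEquiv he hp).symm.toLinearEquiv)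
    (by omega) ?_ _
  rw [hμ p hp]
  intro h0
  refine hμ₀ ?_
  ext w
  have := DFunLike.congr_fun h0 fun i => (chartEquiv he hp).symm (w i)
  rw [AlternatingMap.compLinearMap_apply] at this
  have hw : (fun i => (chartEquiv he hp : TangentSpace 𝓘(ℝ, E) p →L[ℝ] E).toLinearMap
      ((chartEquiv he hp).symm (w i))) = w := funext fun i => (chartEquiv he hp).apply_symm_apply _
  rw [hw] at this
  exact this

theorem pairing_curl {N k : ℕ} (hk : k + 1 ≤ N) (v : Module.Basis (Fin N) ℝ E)
    (he : e ∈ IsManifold.maximalAtlas 𝓘(ℝ, E) ∞ P) {μ : Form E P N} {μ₀ : E [⋀^Fin N]→ₗ[ℝ] ℝ}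
    (hμ₀ : μ₀ ≠ 0)
    (hμ : ∀ q (hq : q ∈ e.source), μ q = μ₀.compLinearMap
      (chartEquiv he hq : TangentSpace 𝓘(ℝ, E) q →L[ℝ] E).toLinearMap)
    {A : MultivectorField E P (k + 1)} {p : P} (hp : p ∈ e.source) {A' : E →ₗ[ℝ] ⋀[ℝ]^(k + 1) E}
    (hA' : ∀ {F : Type u} [NormedAddCommGroup F] [NormedSpace ℝ F]
      (T : ⋀[ℝ]^(k + 1) E →ₗ[ℝ] F), HasFDerivAt (fun y => T (A.inChart e y))
        (LinearMap.toContinuousLinearMap (T ∘ₗ A')) (e p))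
    (τ : Fin k → Module.Dual ℝ (TangentSpace 𝓘(ℝ, E) p)) :
    pairing τ (curl μ A p) = ∑ a, pairing (Fin.snoc τ (v.coord a ∘ₗ
        (chartEquiv he hp : TangentSpace 𝓘(ℝ, E) p →L[ℝ] E).toLinearMap) :
          Fin (k + 1) → Module.Dual ℝ (TangentSpace 𝓘(ℝ, E) p))
      ((chartMultivectorEquiv he hp (k + 1)).symm (A' (v a))) := by
  rw [curl_eq hk v he hμ₀ hμ hp hA', ← pairingLin_apply, map_sum, map_sum]
  refine Finset.sum_congr rfl fun a _ => ?_
  rw [pairingLin_apply, ← pairing_contractCovector]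
  congr 1
  rw [LinearEquiv.symm_apply_eq]
  refine Eq.trans ?_ (map_contractCovector _ _ _).symm
  congr 1
  exact ((chartMultivectorEquiv he hp (k + 1)).apply_symm_apply (A' (v a))).symm

end Curl

/-! ### The standard symplectic space and Darboux charts -/

section DarbouxCharts

variable {m : ℕ}

/-- The linear coordinate `xᵢ`. -/
def xCoord (i : Fin m) : EuclideanSpace ℝ (Fin (2 * m)) →L[ℝ] ℝ := EuclideanSpace.proj (xIndex i)

/-- The linear coordinate `yᵢ`. -/
def yCoord (i : Fin m) : EuclideanSpace ℝ (Fin (2 * m)) →L[ℝ] ℝ := EuclideanSpace.proj (yIndex i)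

/-- The vector `∂/∂xᵢ`. -/
def xVec (i : Fin m) : EuclideanSpace ℝ (Fin (2 * m)) := EuclideanSpace.single (xIndex i) 1

/-- The vector `∂/∂yᵢ`. -/
def yVec (i : Fin m) : EuclideanSpace ℝ (Fin (2 * m)) := EuclideanSpace.single (yIndex i) 1

theorem sum_xIndex_add_sum_yIndex {M : Type*} [AddCommMonoid M] (f : Fin (2 * m) → M) :
    ∑ a, f a = ∑ i : Fin m, (f (xIndex i) + f (yIndex i)) := by
  rw [← Equiv.sum_comp (finCongr (two_mul m)).symm, Fin.sum_univ_add, ← Finset.sum_add_distrib]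
  rfl

theorem xCoord_xVec (i j : Fin m) : xCoord i (xVec j) = if i = j then 1 else 0 := by
  simp [xCoord, xVec, xIndex, Fin.ext_iff]

theorem xCoord_yVec (i j : Fin m) : xCoord i (yVec j) = 0 := by
  simp [xCoord, yVec, xIndex, yIndex, Fin.ext_iff]
  omega

theorem yCoord_xVec (i j : Fin m) : yCoord i (xVec j) = 0 := by
  simp [yCoord, xVec, xIndex, yIndex, Fin.ext_iff]
  omega

theorem yCoord_yVec (i j : Fin m) : yCoord i (yVec j) = if i = j then 1 else 0 := by
  simp [yCoord, yVec, yIndex, Fin.ext_iff]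

theorem sum_coord_smul_vec (w : EuclideanSpace ℝ (Fin (2 * m))) :
    ∑ i, (xCoord i w • xVec i + yCoord i w • yVec i) = w := by
  have h := (EuclideanSpace.basisFun (Fin (2 * m)) ℝ).sum_repr w
  rw [sum_xIndex_add_sum_yIndex] at h
  refine Eq.trans ?_ h
  refine Finset.sum_congr rfl fun i _ => ?_
  simp [xCoord, yCoord, xVec, yVec]

theorem sum_apply_vec_smul_coord (b : EuclideanSpace ℝ (Fin (2 * m)) →L[ℝ] ℝ) :
    b = ∑ i, (b (xVec i) • xCoord i + b (yVec i) • yCoord i) := by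
  ext w
  conv_lhs => rw [← sum_coord_smul_vec w]
  simp only [map_sum, map_add, map_smul, sum_apply, add_apply, smul_apply, smul_eq_mul]
  refine Finset.sum_congr rfl fun i _ => ?_
  ring

/-- The standard symplectic form `∑ᵢ dxᵢ ∧ dyᵢ`. -/
def stdSymplectic : (EuclideanSpace ℝ (Fin (2 * m))) [⋀^Fin 2]→ₗ[ℝ] ℝ :=
  ∑ i : Fin m, covectorWedge ![(xCoord i).toLinearMap, (yCoord i).toLinearMap]

theorem stdSymplectic_apply (u w : EuclideanSpace ℝ (Fin (2 * m))) :
    stdSymplectic ![u, w] = ∑ i, (xCoord i u * yCoord i w - yCoord i u * xCoord i w) := by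
  rw [stdSymplectic, alternatingMap_sum_apply]
  refine Finset.sum_congr rfl fun i _ => ?_
  rw [covectorWedge_apply, Matrix.det_fin_two]
  simp

theorem wedgePow_stdSymplectic_ne_zero : wedgePow (stdSymplectic (m := m)) m ≠ 0 :=
  wedgePow_ne_zero (fun i => (xCoord i).toLinearMap) (fun i => (yCoord i).toLinearMap) xVec yVec
    xCoord_xVec xCoord_yVec yCoord_xVec yCoord_yVec

/-- The inverse of `X ↦ ω(X, ·)` for the standard symplectic form. -/
def stdSharp (b : EuclideanSpace ℝ (Fin (2 * m)) →L[ℝ] ℝ) : EuclideanSpace ℝ (Fin (2 * m)) :=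
  ∑ i, (b (yVec i) • xVec i - b (xVec i) • yVec i)

theorem xCoord_stdSharp (b : EuclideanSpace ℝ (Fin (2 * m)) →L[ℝ] ℝ) (i : Fin m) :
    xCoord i (stdSharp b) = b (yVec i) := by
  simp [stdSharp, xCoord_xVec, xCoord_yVec]

theorem yCoord_stdSharp (b : EuclideanSpace ℝ (Fin (2 * m)) →L[ℝ] ℝ) (i : Fin m) :
    yCoord i (stdSharp b) = -b (xVec i) := by
  simp [stdSharp, yCoord_xVec, yCoord_yVec]

theorem stdSharp_xCoord (i : Fin m) : stdSharp (xCoord i) = -yVec i := by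
  simp [stdSharp, xCoord_xVec, xCoord_yVec]

theorem stdSharp_yCoord (i : Fin m) : stdSharp (yCoord i) = xVec i := by
  simp [stdSharp, yCoord_xVec, yCoord_yVec]

theorem apply_stdSharp_skew (a b : EuclideanSpace ℝ (Fin (2 * m)) →L[ℝ] ℝ) :
    a (stdSharp b) = -b (stdSharp a) := by
  simp only [stdSharp, map_sum, map_sub, map_smul, smul_eq_mul, ← Finset.sum_neg_distrib]
  refine Finset.sum_congr rfl fun i _ => ?_
  ring

theorem stdSymplectic_stdSharp (b : EuclideanSpace ℝ (Fin (2 * m)) →L[ℝ] ℝ)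
    (w : EuclideanSpace ℝ (Fin (2 * m))) : stdSymplectic ![stdSharp b, w] = b w := by
  rw [stdSymplectic_apply]
  conv_rhs => rw [sum_apply_vec_smul_coord b]
  simp only [sum_apply, add_apply, smul_apply, smul_eq_mul, xCoord_stdSharp, yCoord_stdSharp]
  refine Finset.sum_congr rfl fun i _ => ?_
  ring

theorem stdSymplectic_nondegenerate {u u' : EuclideanSpace ℝ (Fin (2 * m))}
    (h : ∀ w, stdSymplectic ![u, w] = stdSymplectic ![u', w]) : u = u' := by
  have hx : ∀ i, xCoord i u = xCoord i u' := fun i => by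
    simpa [stdSymplectic_apply, xCoord_yVec, yCoord_yVec] using h (yVec i)
  have hy : ∀ i, yCoord i u = yCoord i u' := fun i => by
    simpa [stdSymplectic_apply, xCoord_xVec, yCoord_xVec] using h (xVec i)
  rw [← sum_coord_smul_vec u, ← sum_coord_smul_vec u']
  simp only [hx, hy]

variable {P : Type*} [TopologicalSpace P] [ChartedSpace (EuclideanSpace ℝ (Fin (2 * m))) P]
  {σ : Form (EuclideanSpace ℝ (Fin (2 * m))) P 2}
  {e : OpenPartialHomeomorph P (EuclideanSpace ℝ (Fin (2 * m)))}

theorem dx_eq_constForm (he : e ∈ IsManifold.maximalAtlas 𝓘(ℝ, EuclideanSpace ℝ (Fin (2 * m))) ∞ P)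
    {q : P} (hq : q ∈ e.source)
    (i : Fin m) : dx e i q = constForm e (xCoord i) q := by
  ext w
  exact differential_comp_chart he hq (xCoord i).hasFDerivAt Filter.EventuallyEq.rfl w

theorem dy_eq_constForm (he : e ∈ IsManifold.maximalAtlas 𝓘(ℝ, EuclideanSpace ℝ (Fin (2 * m))) ∞ P)
    {q : P} (hq : q ∈ e.source)
    (i : Fin m) : dy e i q = constForm e (yCoord i) q := by
  ext w
  exact differential_comp_chart he hq (yCoord i).hasFDerivAt Filter.EventuallyEq.rfl w

theorem IsDarboux.eq_stdSymplectic (he : IsDarboux σ e) {q : P} (hq : q ∈ e.source) :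
    σ q = stdSymplectic.compLinearMap
      (chartEquiv he.1 hq : TangentSpace 𝓘(ℝ, EuclideanSpace ℝ (Fin (2 * m))) q →L[ℝ]
        EuclideanSpace ℝ (Fin (2 * m))).toLinearMap := by
  rw [he.2 q hq]
  ext v
  rw [AlternatingMap.compLinearMap_apply, stdSymplectic, alternatingMap_sum_apply,
    alternatingMap_sum_apply]
  refine Finset.sum_congr rfl fun i _ => ?_
  rw [← AlternatingMap.compLinearMap_apply, covectorWedge_compLinearMap, OneForm.toForm,
    OneForm.toForm, wedge_ofSubsingleton, dx_eq_constForm he.1 hq, dy_eq_constForm he.1 hq]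
  congr 2
  ext j : 1
  fin_cases j <;> rfl

/-- Wedge powers commute with pullback, so the volume form inherits constant coefficients from the
symplectic form, as `curl_eq` requires. -/
theorem IsDarboux.liouville_eq (he : IsDarboux σ e) {q : P} (hq : q ∈ e.source) :
    liouville σ m q = (((m.factorial : ℝ)⁻¹) • wedgePow stdSymplectic m).compLinearMap
      (chartEquiv he.1 hq : TangentSpace 𝓘(ℝ, EuclideanSpace ℝ (Fin (2 * m))) q →L[ℝ]
        EuclideanSpace ℝ (Fin (2 * m))).toLinearMap := by
  rw [liouville, he.eq_stdSymplectic hq, wedgePow_compLinearMap]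
  rfl

theorem contractVector_apply {p : P}
    (η : (TangentSpace 𝓘(ℝ, EuclideanSpace ℝ (Fin (2 * m))) p) [⋀^Fin 2]→ₗ[ℝ] ℝ)
    (v w : TangentSpace 𝓘(ℝ, EuclideanSpace ℝ (Fin (2 * m))) p) :
    contractVector η v w = η ![v, w] := by
  change η (Matrix.vecCons v fun _ => w) = _
  congr 1
  ext i : 1
  fin_cases i <;> rfl

theorem IsDarboux.flat_apply (he : IsDarboux σ e) {q : P} (hq : q ∈ e.source)
    (v w : TangentSpace 𝓘(ℝ, EuclideanSpace ℝ (Fin (2 * m))) q) :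
    flat σ q v w = stdSymplectic ![chartEquiv he.1 hq v, chartEquiv he.1 hq w] := by
  rw [flat, contractVector_apply, he.eq_stdSymplectic hq, AlternatingMap.compLinearMap_apply]
  congr 1
  ext i : 1
  fin_cases i <;> rfl

/-- Because `sharp` is a `Function.invFun`, its value is identified by showing that `flat` is
injective and that the right-hand side is a preimage of `β`. -/
theorem IsDarboux.sharp_apply (he : IsDarboux σ e) {q : P} (hq : q ∈ e.source)
    (β : TangentSpace 𝓘(ℝ, EuclideanSpace ℝ (Fin (2 * m))) q →L[ℝ] ℝ) :
    sharp σ q β = (chartEquiv he.1 hq).symm (stdSharp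
      (β.comp ((chartEquiv he.1 hq).symm :
        EuclideanSpace ℝ (Fin (2 * m)) →L[ℝ]
          TangentSpace 𝓘(ℝ, EuclideanSpace ℝ (Fin (2 * m))) q))) := by
  have hinj : Function.Injective (flat σ q) := by
    intro v v' h
    refine (chartEquiv he.1 hq).injective (stdSymplectic_nondegenerate fun w => ?_)
    have := DFunLike.congr_fun h ((chartEquiv he.1 hq).symm w)
    rw [he.flat_apply hq, he.flat_apply hq, ContinuousLinearEquiv.apply_symm_apply] at this
    exact this
  have hβ : flat σ q ((chartEquiv he.1 hq).symm (stdSharp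
      (β.comp ((chartEquiv he.1 hq).symm :
        EuclideanSpace ℝ (Fin (2 * m)) →L[ℝ]
          TangentSpace 𝓘(ℝ, EuclideanSpace ℝ (Fin (2 * m))) q)))) = β := by
    ext w
    rw [he.flat_apply hq, ContinuousLinearEquiv.apply_symm_apply, stdSymplectic_stdSharp]
    exact congrArg β ((chartEquiv he.1 hq).symm_apply_apply w)
  conv_lhs => rw [← hβ]
  exact Function.leftInverse_invFun hinj _

theorem IsDarboux.sharp_constForm (he : IsDarboux σ e) {q : P} (hq : q ∈ e.source)
    (b : EuclideanSpace ℝ (Fin (2 * m)) →L[ℝ] ℝ) :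
    sharp σ q (constForm e b q) = (chartEquiv he.1 hq).symm (stdSharp b) := by
  rw [he.sharp_apply hq]
  congr 2
  ext w
  exact congrArg b ((chartEquiv he.1 hq).apply_symm_apply w)

theorem IsDarboux.poisson_constForm (he : IsDarboux σ e) {q : P} (hq : q ∈ e.source)
    (a b : EuclideanSpace ℝ (Fin (2 * m)) →L[ℝ] ℝ) :
    poisson σ (constForm e a) (constForm e b) q = a (stdSharp b) := by
  rw [poisson, he.sharp_constForm hq]
  exact congrArg a ((chartEquiv he.1 hq).apply_symm_apply _)

theorem contractVector_zero {p : P} (v : TangentSpace 𝓘(ℝ, EuclideanSpace ℝ (Fin (2 * m))) p) :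
    contractVector (0 : (TangentSpace 𝓘(ℝ, EuclideanSpace ℝ (Fin (2 * m))) p) [⋀^Fin 2]→ₗ[ℝ] ℝ) v
      = 0 := by
  ext w
  rw [contractVector_apply]
  rfl

variable [IsManifold 𝓘(ℝ, EuclideanSpace ℝ (Fin (2 * m))) ∞ P]

theorem d_toForm_constForm
    (he : e ∈ IsManifold.maximalAtlas 𝓘(ℝ, EuclideanSpace ℝ (Fin (2 * m))) ∞ P) {p : P}
    (hp : p ∈ e.source) (a : EuclideanSpace ℝ (Fin (2 * m)) →L[ℝ] ℝ) :
    (constForm e a).toForm.d p = 0 := by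
  have hev : (constForm e a).toForm.inChart e =ᶠ[𝓝 (e p)] fun _ =>
      toContinuousForm (AlternatingMap.ofSubsingleton ℝ (EuclideanSpace ℝ (Fin (2 * m))) ℝ
        (0 : Fin 1) a.toLinearMap) := by
    filter_upwards [e.open_target.mem_nhds (e.map_source hp)] with y hy
    obtain ⟨q, hq, rfl⟩ : ∃ q ∈ e.source, e q = y := ⟨_, e.map_target hy, e.right_inv hy⟩
    ext v
    rw [Form.inChart_apply he hq]
    exact congrArg a ((chartEquiv he hq).apply_symm_apply (v 0))
  rw [Form.d_eq_extDeriv_inChart _ he hp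
    ((differentiableAt_const _).congr_of_eventuallyEq hev), hev.extDeriv_eq]
  have h0 : extDeriv (fun _ : EuclideanSpace ℝ (Fin (2 * m)) =>
      toContinuousForm (AlternatingMap.ofSubsingleton ℝ (EuclideanSpace ℝ (Fin (2 * m))) ℝ
        (0 : Fin 1) a.toLinearMap)) (e p) = 0 := by
    rw [extDeriv, fderiv_const_apply]
    exact map_zero (ContinuousAlternatingMap.alternatizeUncurryFinCLM ℝ _ _)
  rw [h0]
  rfl

/-- Constant-coefficient forms are closed and their Poisson pairings are constant on the chart, so
both Lie derivatives and the differential vanish separately. -/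
theorem IsDarboux.oneFormBracket_constForm (he : IsDarboux σ e) {p : P} (hp : p ∈ e.source)
    (a b : EuclideanSpace ℝ (Fin (2 * m)) →L[ℝ] ℝ) :
    oneFormBracket σ (constForm e a) (constForm e b) p = 0 := by
  have h : ∀ a b : EuclideanSpace ℝ (Fin (2 * m)) →L[ℝ] ℝ, differential
      (E := EuclideanSpace ℝ (Fin (2 * m)))
      (poisson σ (constForm e a) (constForm e b)) p = 0 := by
    intro a b
    refine differential_of_eventuallyEq_const (c := a (stdSharp b)) ?_
    filter_upwards [e.open_source.mem_nhds hp] with q hq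
    exact he.poisson_constForm hq a b
  have hl : ∀ a b : EuclideanSpace ℝ (Fin (2 * m)) →L[ℝ] ℝ,
      lieDerivative (fun q => sharp σ q (constForm e a q)) (constForm e b) p = 0 := by
    intro a b
    rw [lieDerivative, d_toForm_constForm he.1 hp, contractVector_zero, add_zero]
    exact h b a
  rw [oneFormBracket]
  simp only [Pi.add_apply, Pi.sub_apply, hl, h, sub_zero, add_zero]

end DarbouxCharts

/-! ### Symmetry and symplecticity of the Christoffel symbols -/

namespace ContravariantDerivative

variable {m : ℕ} {P : Type*} [TopologicalSpace P]
  [ChartedSpace (EuclideanSpace ℝ (Fin (2 * m))) P]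
  [IsManifold 𝓘(ℝ, EuclideanSpace ℝ (Fin (2 * m))) ∞ P]
  {σ : Form (EuclideanSpace ℝ (Fin (2 * m))) P 2} (D : ContravariantDerivative σ)
  {e : OpenPartialHomeomorph P (EuclideanSpace ℝ (Fin (2 * m)))}

/-- Zero torsion is evaluated on constant-coefficient extensions of `α` and `β`, whose bracket is
zero. -/
theorem christoffel_symm (hT : D.IsTorsionFree) (he : IsDarboux σ e) {p : P} (hp : p ∈ e.source)
    (α β : TangentSpace 𝓘(ℝ, EuclideanSpace ℝ (Fin (2 * m))) p →L[ℝ] ℝ) :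
    D.christoffel he.1 hp α β = D.christoffel he.1 hp β α := by
  let L := ((chartEquiv he.1 hp).symm : EuclideanSpace ℝ (Fin (2 * m)) →L[ℝ]
    TangentSpace 𝓘(ℝ, EuclideanSpace ℝ (Fin (2 * m))) p)
  have hL : ∀ γ : TangentSpace 𝓘(ℝ, EuclideanSpace ℝ (Fin (2 * m))) p →L[ℝ] ℝ,
      constForm e (γ.comp L) p = γ := by
    intro γ
    ext v
    exact congrArg γ ((chartEquiv he.1 hp).symm_apply_apply v)
  have h := hT (constForm e (α.comp L)) (constForm e (β.comp L)) p
    (smoothAt_constForm he.1 hp _) (smoothAt_constForm he.1 hp _)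
  rw [Pi.sub_apply, Pi.sub_apply, he.oneFormBracket_constForm hp, sub_zero, sub_eq_zero] at h
  have h' : D.toFun (constForm e (β.comp L)) p (constForm e (α.comp L) p)
      = D.toFun (constForm e (α.comp L)) p (constForm e (β.comp L) p) := h
  rw [hL, hL] at h'
  exact h'

/-- The Poisson pairing of constant forms is constant, so `DΠ = 0` reads `(Γa)(♯b) + a(♯Γb) = 0`;
skewness of the Poisson tensor turns the second term into `-(Γb)(♯a)`. -/
theorem christoffel_symplectic (hD : D.IsPoissonConnection) (he : IsDarboux σ e) {p : P}
    (hp : p ∈ e.source) (α : TangentSpace 𝓘(ℝ, EuclideanSpace ℝ (Fin (2 * m))) p →L[ℝ] ℝ)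
    (a b : EuclideanSpace ℝ (Fin (2 * m)) →L[ℝ] ℝ) :
    D.christoffel he.1 hp α (constForm e a p) ((chartEquiv he.1 hp).symm (stdSharp b))
      = D.christoffel he.1 hp α (constForm e b p) ((chartEquiv he.1 hp).symm (stdSharp a)) := by
  let L := ((chartEquiv he.1 hp).symm : EuclideanSpace ℝ (Fin (2 * m)) →L[ℝ]
    TangentSpace 𝓘(ℝ, EuclideanSpace ℝ (Fin (2 * m))) p)
  have hL : constForm e (α.comp L) p = α := by
    ext v
    exact congrArg α ((chartEquiv he.1 hp).symm_apply_apply v)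
  have h := hD (constForm e (α.comp L)) (constForm e a) (constForm e b) p
    (smoothAt_constForm he.1 hp _) (smoothAt_constForm he.1 hp _) (smoothAt_constForm he.1 hp _)
  have hc : ∀ᶠ q in 𝓝 p, poisson σ (constForm e a) (constForm e b) q = a (stdSharp b) := by
    filter_upwards [e.open_source.mem_nhds hp] with q hq
    exact he.poisson_constForm hq a b
  have h1 : ∀ c : EuclideanSpace ℝ (Fin (2 * m)) →L[ℝ] ℝ,
      D.onOneForm (constForm e (α.comp L)) (constForm e c) p
        = D.christoffel he.1 hp α (constForm e c p) := by
    intro c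
    rw [constForm_apply he.1 hp c, christoffel_comp, onOneForm, hL]
  rw [differential_of_eventuallyEq_const hc, zero_apply, poisson, poisson, h1, h1,
    he.sharp_constForm hp, he.sharp_apply hp] at h
  have h2 : constForm e a p ((chartEquiv he.1 hp).symm (stdSharp
      ((D.christoffel he.1 hp α (constForm e b p)).comp L)))
      = a (stdSharp ((D.christoffel he.1 hp α (constForm e b p)).comp L)) :=
    congrArg a ((chartEquiv he.1 hp).apply_symm_apply _)
  rw [h2, apply_stdSharp_skew] at h
  exact eq_of_sub_eq_zero (by rw [sub_eq_add_neg]; exact h.symm)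

end ContravariantDerivative

section Pairing

variable {V : Type*} [AddCommGroup V] [Module ℝ V] {k : ℕ}

theorem pairing_sum {ι : Type*} (α : Fin k → Module.Dual ℝ V) (s : Finset ι)
    (A : ι → ⋀[ℝ]^k V) : pairing α (∑ i ∈ s, A i) = ∑ i ∈ s, pairing α (A i) :=
  map_sum (pairingLin α) A s

theorem pairing_sub (α : Fin k → Module.Dual ℝ V) (A B : ⋀[ℝ]^k V) :
    pairing α (A - B) = pairing α A - pairing α B :=
  map_sub (pairingLin α) A B

theorem pairing_neg (α : Fin k → Module.Dual ℝ V) (A : ⋀[ℝ]^k V) :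
    pairing α (-A) = -pairing α A :=
  map_neg (pairingLin α) A

end Pairing

/-! ### Assembling the two sides in a Darboux chart -/

section CurlFormula

variable {m : ℕ} {P : Type*} [TopologicalSpace P]
  [ChartedSpace (EuclideanSpace ℝ (Fin (2 * m))) P]
  {e : OpenPartialHomeomorph P (EuclideanSpace ℝ (Fin (2 * m)))}

theorem apply_chartEquiv_symm_eq_sum
    (he : e ∈ IsManifold.maximalAtlas 𝓘(ℝ, EuclideanSpace ℝ (Fin (2 * m))) ∞ P) {p : P}
    (hp : p ∈ e.source)
    (β : TangentSpace 𝓘(ℝ, EuclideanSpace ℝ (Fin (2 * m))) p →L[ℝ] ℝ) :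
    β.toLinearMap = ∑ i, (β ((chartEquiv he hp).symm (xVec i)) •
        (constForm e (xCoord i) p).toLinearMap
      + β ((chartEquiv he hp).symm (yVec i)) • (constForm e (yCoord i) p).toLinearMap) := by
  ext w
  have h := DFunLike.congr_fun (sum_apply_vec_smul_coord
    (β.comp ((chartEquiv he hp).symm : EuclideanSpace ℝ (Fin (2 * m)) →L[ℝ]
      TangentSpace 𝓘(ℝ, EuclideanSpace ℝ (Fin (2 * m))) p))) (chartEquiv he hp w)
  have h1 : β w = β ((chartEquiv he hp).symm (chartEquiv he hp w)) :=
    congrArg β ((chartEquiv he hp).symm_apply_apply w).symm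
  refine h1.trans (h.trans ?_)
  rw [LinearMap.sum_apply, sum_apply]
  rfl

variable [IsManifold 𝓘(ℝ, EuclideanSpace ℝ (Fin (2 * m))) ∞ P]
  {σ : Form (EuclideanSpace ℝ (Fin (2 * m))) P 2}

/-- The terms of `∑ᵢ (i(dxᵢ) D_{dyᵢ} A - i(dyᵢ) D_{dxᵢ} A)` that involve the Christoffel symbols
cancel. -/
theorem ContravariantDerivative.sum_christoffelDual_eq_zero (D : ContravariantDerivative σ)
    (hD : D.IsPoissonConnection) (hT : D.IsTorsionFree) (he : IsDarboux σ e) {p : P}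
    (hp : p ∈ e.source) {k : ℕ}
    (M : (Module.Dual ℝ (TangentSpace 𝓘(ℝ, EuclideanSpace ℝ (Fin (2 * m))) p))
      [⋀^Fin (k + 1)]→ₗ[ℝ] ℝ)
    (τ : Fin k → Module.Dual ℝ (TangentSpace 𝓘(ℝ, EuclideanSpace ℝ (Fin (2 * m))) p)) :
    ∑ i, (derivationAlt M (D.christoffelDual he.1 hp (constForm e (yCoord i) p))
          (Fin.snoc τ (constForm e (xCoord i) p).toLinearMap : Fin (k + 1) → Module.Dual ℝ _)
      - derivationAlt M (D.christoffelDual he.1 hp (constForm e (xCoord i) p))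
          (Fin.snoc τ (constForm e (yCoord i) p).toLinearMap : Fin (k + 1) → Module.Dual ℝ _))
      = 0 := by
  let L := chartEquiv he.1 hp
  let Γ : Module.Dual ℝ (TangentSpace 𝓘(ℝ, EuclideanSpace ℝ (Fin (2 * m))) p) →
      (EuclideanSpace ℝ (Fin (2 * m)) →L[ℝ] ℝ) →
      (TangentSpace 𝓘(ℝ, EuclideanSpace ℝ (Fin (2 * m))) p →L[ℝ] ℝ) :=
    fun a b => D.christoffel he.1 hp (LinearMap.toContinuousLinearMap a) (constForm e b p)
  have hΓ : ∀ a b c, Γ a b (L.symm (stdSharp c)) = Γ a c (L.symm (stdSharp b)) := fun a b c =>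
    D.christoffel_symplectic hD he hp _ b c
  have hsub : ∀ (r s : ℝ)
      (X Y : Module.Dual ℝ (TangentSpace 𝓘(ℝ, EuclideanSpace ℝ (Fin (2 * m))) p)),
      r • X + s • Y = r • X - (-s) • Y := fun r s X Y => by
        ext w
        change r * X w + s * Y w = r * X w - -s * Y w
        ring
  -- The matrices `S`, `Q`, `R` are the components of `Γ_a dyᵢ` and `Γ_a dxᵢ` on the coordinate
  -- vectors. Since these vectors are `♯dyⱼ` and `-♯dxⱼ`, the identity `hΓ` becomes symmetry of `S`
  -- and `R`.
  refine sum_derivationAlt_eq_zero M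
    (fun a => D.christoffelDual he.1 hp (LinearMap.toContinuousLinearMap a)) ?_
    (fun i => (constForm e (xCoord i) p).toLinearMap)
    (fun i => (constForm e (yCoord i) p).toLinearMap)
    (fun a i j => Γ a (yCoord i) (L.symm (xVec j)))
    (fun a i j => -Γ a (yCoord i) (L.symm (yVec j)))
    (fun a i j => -Γ a (xCoord i) (L.symm (yVec j))) ?_ ?_ ?_ ?_ τ
  · intro a b
    exact congrArg ContinuousLinearMap.toLinearMap (D.christoffel_symm hT he hp _ _)
  · intro a i j
    have h := hΓ a (yCoord i) (yCoord j)
    rwa [stdSharp_yCoord, stdSharp_yCoord] at h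
  · intro a i j
    have h := hΓ a (xCoord i) (xCoord j)
    rwa [stdSharp_xCoord, stdSharp_xCoord, map_neg, map_neg, map_neg, map_neg] at h
  · intro a i
    refine (apply_chartEquiv_symm_eq_sum he.1 hp (Γ a (yCoord i))).trans ?_
    simp only [neg_smul, sub_neg_eq_add]
    rfl
  · intro a i
    refine (apply_chartEquiv_symm_eq_sum he.1 hp (Γ a (xCoord i))).trans ?_
    refine Finset.sum_congr rfl fun j _ => ?_
    -- The mixed case of `hΓ`: the `xⱼ`-component of `Γ_a dxᵢ` is minus the `yᵢ`-component of `Γ_a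
    -- dyⱼ`, which is `Q a j i`.
    have h := hΓ a (xCoord i) (yCoord j)
    rw [stdSharp_xCoord, stdSharp_yCoord, map_neg, map_neg] at h
    change Γ a (xCoord i) (L.symm (xVec j)) • _ + Γ a (xCoord i) (L.symm (yVec j)) • _ = _
    rw [h]
    exact hsub _ _ _ _

/-- The formula for `i(ε) D_η A` in a Darboux chart. -/
theorem ContravariantDerivative.pairing_contractCovector_onMultivector
    (D : ContravariantDerivative σ) (he : IsDarboux σ e) {p : P} (hp : p ∈ e.source) {k : ℕ}
    {A : MultivectorField (EuclideanSpace ℝ (Fin (2 * m))) P (k + 1)}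
    {A' : EuclideanSpace ℝ (Fin (2 * m)) →ₗ[ℝ] ⋀[ℝ]^(k + 1) (EuclideanSpace ℝ (Fin (2 * m)))}
    (hA' : HasFDerivAt (fun y => pairingCont (k + 1) (A.inChart e y))
        (LinearMap.toContinuousLinearMap (pairingCont (k + 1) ∘ₗ A')) (e p))
    {η : OneForm (EuclideanSpace ℝ (Fin (2 * m))) P} {b : EuclideanSpace ℝ (Fin (2 * m)) →L[ℝ] ℝ}
    (h : η p = constForm e b p)
    (ε : Module.Dual ℝ (TangentSpace 𝓘(ℝ, EuclideanSpace ℝ (Fin (2 * m))) p))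
    (τ : Fin k → Module.Dual ℝ (TangentSpace 𝓘(ℝ, EuclideanSpace ℝ (Fin (2 * m))) p)) :
    pairing τ (contractCovector ε (D.onMultivector η A p))
      = pairing (Fin.snoc τ ε : Fin (k + 1) → Module.Dual ℝ _)
          ((chartMultivectorEquiv he.1 hp (k + 1)).symm (A' (stdSharp b)))
        - derivationAlt (pairingAlt (A p)) (D.christoffelDual he.1 hp (constForm e b p))
          (Fin.snoc τ ε : Fin (k + 1) → Module.Dual ℝ _) := by
  rw [pairing_contractCovector, D.pairing_onMultivector he.1 hp hA', h, he.sharp_constForm hp,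
    ContinuousLinearEquiv.apply_symm_apply]

/-- The formula for the curl operator of the Liouville volume form in a Darboux chart. -/
theorem IsDarboux.pairing_curl_liouville (he : IsDarboux σ e) {p : P} (hp : p ∈ e.source) {k : ℕ}
    (hk : k + 1 ≤ 2 * m) {A : MultivectorField (EuclideanSpace ℝ (Fin (2 * m))) P (k + 1)}
    {A' : EuclideanSpace ℝ (Fin (2 * m)) →ₗ[ℝ] ⋀[ℝ]^(k + 1) (EuclideanSpace ℝ (Fin (2 * m)))}
    (hA' : ∀ {F : Type} [NormedAddCommGroup F] [NormedSpace ℝ F]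
      (T : ⋀[ℝ]^(k + 1) (EuclideanSpace ℝ (Fin (2 * m))) →ₗ[ℝ] F),
      HasFDerivAt (fun y => T (A.inChart e y))
        (LinearMap.toContinuousLinearMap (T ∘ₗ A')) (e p))
    (τ : Fin k → Module.Dual ℝ (TangentSpace 𝓘(ℝ, EuclideanSpace ℝ (Fin (2 * m))) p)) :
    pairing τ (curl (liouville σ m) A p)
      = ∑ i, (pairing (Fin.snoc τ (constForm e (xCoord i) p).toLinearMap :
            Fin (k + 1) → Module.Dual ℝ _)
          ((chartMultivectorEquiv he.1 hp (k + 1)).symm (A' (xVec i)))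
        + pairing (Fin.snoc τ (constForm e (yCoord i) p).toLinearMap :
            Fin (k + 1) → Module.Dual ℝ _)
          ((chartMultivectorEquiv he.1 hp (k + 1)).symm (A' (yVec i)))) := by
  have hμ₀ : ((m.factorial : ℝ)⁻¹) • wedgePow (stdSymplectic (m := m)) m ≠ 0 :=
    smul_ne_zero (inv_ne_zero (Nat.cast_ne_zero.mpr m.factorial_ne_zero))
      wedgePow_stdSymplectic_ne_zero
  rw [pairing_curl hk (EuclideanSpace.basisFun (Fin (2 * m)) ℝ).toBasis he.1 hμ₀
    (fun q hq => he.liouville_eq hq) hp hA' τ, sum_xIndex_add_sum_yIndex]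
  refine Finset.sum_congr rfl fun i _ => ?_
  have hv : ∀ j, (EuclideanSpace.basisFun (Fin (2 * m)) ℝ).toBasis j
      = EuclideanSpace.single j 1 := fun j => by simp
  rw [hv, hv]
  rfl

set_option maxHeartbeats 600000 in
/-- The summands of the curl formula, paired with covectors. -/
theorem ContravariantDerivative.pairing_curl_summand
    (D : ContravariantDerivative σ) (he : IsDarboux σ e) {p : P} (hp : p ∈ e.source) {k : ℕ}
    {A : MultivectorField (EuclideanSpace ℝ (Fin (2 * m))) P (k + 1)}
    {A' : EuclideanSpace ℝ (Fin (2 * m)) →ₗ[ℝ] ⋀[ℝ]^(k + 1) (EuclideanSpace ℝ (Fin (2 * m)))}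
    (hA' : HasFDerivAt (fun y => pairingCont (k + 1) (A.inChart e y))
        (LinearMap.toContinuousLinearMap (pairingCont (k + 1) ∘ₗ A')) (e p))
    (τ : Fin k → Module.Dual ℝ (TangentSpace 𝓘(ℝ, EuclideanSpace ℝ (Fin (2 * m))) p))
    (i : Fin m) :
    pairing τ (contractCovector (dx e i p).toLinearMap (D.onMultivector (dy e i) A p)
        - contractCovector (dy e i p).toLinearMap (D.onMultivector (dx e i) A p))
      = pairing (Fin.snoc τ (constForm e (xCoord i) p).toLinearMap :
            Fin (k + 1) → Module.Dual ℝ _)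
          ((chartMultivectorEquiv he.1 hp (k + 1)).symm (A' (xVec i)))
        + pairing (Fin.snoc τ (constForm e (yCoord i) p).toLinearMap :
            Fin (k + 1) → Module.Dual ℝ _)
          ((chartMultivectorEquiv he.1 hp (k + 1)).symm (A' (yVec i)))
        - (derivationAlt (pairingAlt (A p)) (D.christoffelDual he.1 hp (constForm e (yCoord i) p))
          (Fin.snoc τ (constForm e (xCoord i) p).toLinearMap : Fin (k + 1) → Module.Dual ℝ _)
        - derivationAlt (pairingAlt (A p)) (D.christoffelDual he.1 hp (constForm e (xCoord i) p))
          (Fin.snoc τ (constForm e (yCoord i) p).toLinearMap :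
            Fin (k + 1) → Module.Dual ℝ _)) := by
  -- The minus sign in `♯dxᵢ = -∂/∂yᵢ` cancels the one in the formula, so both coordinate
  -- derivatives enter with a plus.
  have hx : (chartMultivectorEquiv he.1 hp (k + 1)).symm (A' (stdSharp (xCoord i)))
      = -(chartMultivectorEquiv he.1 hp (k + 1)).symm (A' (yVec i)) := by
    rw [stdSharp_xCoord, map_neg A', map_neg]
  have hdx := dx_eq_constForm he.1 hp i
  have hdy := dy_eq_constForm he.1 hp i
  have h1 := D.pairing_contractCovector_onMultivector he hp hA' hdy
    (constForm e (xCoord i) p).toLinearMap τ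
  have h2 := D.pairing_contractCovector_onMultivector he hp hA' hdx
    (constForm e (yCoord i) p).toLinearMap τ
  rw [stdSharp_yCoord] at h1
  rw [hx, pairing_neg] at h2
  rw [pairing_sub, hdx, hdy, h1, h2]
  ring

end CurlFormula

end PoissonCurl

theorem mainTheorem5 {m : ℕ} {P : Type*} [TopologicalSpace P]
    [ChartedSpace (EuclideanSpace ℝ (Fin (2 * m))) P] [IsManifold (𝓡 (2 * m)) ∞ P]
    (σ : PoissonCurl.Form (EuclideanSpace ℝ (Fin (2 * m))) P 2)
    (hσ : PoissonCurl.IsSymplectic σ)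
    (D : PoissonCurl.ContravariantDerivative σ)
    (hD : D.IsPoissonConnection) (hT : D.IsTorsionFree)
    (e : OpenPartialHomeomorph P (EuclideanSpace ℝ (Fin (2 * m))))
    (he : PoissonCurl.IsDarboux σ e)
    (k : ℕ) (hk : k + 1 ≤ 2 * m)
    (A : PoissonCurl.MultivectorField (EuclideanSpace ℝ (Fin (2 * m))) P (k + 1))
    (hA : ∀ p ∈ e.source, A.SmoothAt p) :
    ∀ p ∈ e.source,
      PoissonCurl.curl (PoissonCurl.liouville σ m) A p =
        ∑ i : Fin m,
          (PoissonCurl.contractCovector (PoissonCurl.dx e i p).toLinearMap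
              (D.onMultivector (PoissonCurl.dy e i) A p)
            - PoissonCurl.contractCovector (PoissonCurl.dy e i p).toLinearMap
              (D.onMultivector (PoissonCurl.dx e i) A p)) := by

  intro p hp
  obtain ⟨A', hA'⟩ := (hA p hp).exists_hasFDerivAt he.1 hp
  refine PoissonCurl.pairing_ext fun τ => ?_
  have hA'' := hA' (F := (EuclideanSpace ℝ (Fin (2 * m)) →L[ℝ] ℝ) [⋀^Fin (k + 1)]→L[ℝ] ℝ)
    (PoissonCurl.pairingCont (k + 1))
  rw [he.pairing_curl_liouville hp hk hA' τ, PoissonCurl.pairing_sum]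
  simp only [D.pairing_curl_summand he hp hA'' τ]
  -- The divergence parts of the two sides are now identical; only the Christoffel sum remains, and
  -- it is zero.
  rw [Finset.sum_sub_distrib, D.sum_christoffelDual_eq_zero hD hT he hp, sub_zero]
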